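/- Let $A$ be a unital $C^*$-algebra, $\alpha:A\to A$ a $*$-endomorphism (not necessarily unital), and $J$ a closed two-sided ideal of $A$ with $J\cap\ker\alpha=\{0\}$. **Universal crossed product.** A $J$-covariant representation of $(A,\alpha)$ in a unital $C^*$-algebra $D$ is a pair $(\pi,U)$ consisting of a unital $*$-homomorphism $\pi:A\to D$ and $U\in D$ with $U\pi(a)U^*=\pi(\alpha(a))$ for all $a\in A$ and $J=\{a\in A: U^*U\pi(a)=\pi(a)\}$. A universal crossed product is a triple $(B,i,v)$ where $B$ is a unital $C^*$-algebra, $(i,v)$ is a $J$-covariant representation of $(A,\alpha)$ in $B$ with $v$ a partial isometry, $B$ is generated as a $C^*$-algebra by $i(A)\cup\{v\}$, and for each $J$-covariant representation $(\pi,U)$ in a unital $C^*$-algebra $D$ there is a unital $*$-homomorphism $\varphi:B\to D$ with $\varphi\circ i=\pi$ and $\varphi(v)=U$. **Matrix crossed product.** Let $\mathcal M(A)$ be the set of matrices $a=(a_{m,n})_{m,n\ge 0}$ with $a_{m,n}\in\alpha^m(1)A\alpha^n(1)$ and only finitely many nonzero entries, with entrywise linear operations, involution $(a^*)_{m,n}=a_{n,m}^*$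 and product $$a\star b=a\cdot\sum_{j\ge0}\Lambda^j(b)+\sum_{j\ge1}\Lambda^j(a)\cdot b,$$ where $\cdot$ is the usual matrix product, $\Lambda(a)_{m,n}=\alpha(a_{m-1,n-1})$ if $m,n\ge1$ and $\Lambda(a)_{m,n}=0$ otherwise; $\mathcal M(A)$ is a unital $*$-algebra. For $k\in\mathbb Z$, $n\ge0$ put $a^{(k)}_n=a_{n,n+k}$ if $k\ge0$ and $a^{(k)}_n=a_{n-k,n}$ if $k<0$, and let $$|||a|||_J=\sum_{k\in\mathbb Z}\lim_{n\to\infty}\max\Big\{\max_{0\le i\le n} d\Big(\sum_{j=0}^{i}\alpha^{i-j}(a^{(k)}_j),J\Big),\ d\Big(\sum_{j=0}^{n}\alpha^{n-j}(a^{(k)}_j),\ker\alpha\Big)\Big\},$$ where $d(x,K)=\inf_{y\in K}\|x-y\|$. All these limits exist, and $\{a:|||a|||_J=0\}$ is a self-adjoint two-sided ideal of $\mathcal M(A)$; let $\mathcal M(A)/|||\cdot|||_J$ be the quotient $*$-algebra. An enveloping $C^*$-algebra of a unital $*$-algebra $S$ is a unital $C^*$-algebra $C$ with a unital $*$-homomorphism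 $\iota:S\to C$ with dense range such that every unital $*$-homomorphism from $S$ to a unital $C^*$-algebra $D$ is of the form $\varphi\circ\iota$ for some unital $*$-homomorphism $\varphi:C\to D$. **Proposition.** A universal crossed product $(B,i,v)$ with $i$ injective exists, and an enveloping $C^*$-algebra $(C,\iota)$ of $\mathcal M(A)/|||\cdot|||_J$ exists. The two crossed products are canonically isomorphic: for every universal crossed product $(B,i,v)$ and every enveloping $C^*$-algebra $(C,\iota)$ of $\mathcal M(A)/|||\cdot|||_J$ there is exactly one $*$-isomorphism $\varphi:B\to C$ such that $\varphi(i(a))=\iota([a])$ for all $a\in A$ and $\varphi(v)=\iota([u])$. Here $a\in A$ is regarded as the matrix with $a$ at position $(0,0)$ and zeros elsewhere, $u$ is the matrix with $\alpha(1)$ at position $(0,1)$ and zeros elsewhere, and $[\,\cdot\,]$ denotes the class in $\mathcal M(A)/|||\cdot|||_J$. -/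

import Mathlib

open Filter Topology

universe u

namespace EndoCrossed

section MatrixAlgebra

set_option linter.unusedSectionVars false

variable {A : Type u} [CStarAlgebra A]

/-- The standard product of infinite matrices (used for row-finite left factors only). -/
noncomputable def infMul (x y : Matrix ℕ ℕ A) : Matrix ℕ ℕ A :=
  fun m n => ∑ᶠ k, x m k * y k n

/-- The shift `Λ`: `Λ(a) i j = α (a (i-1) (j-1))` for `i, j > 0`, and `0` otherwise. -/
noncomputable def Lam (α : A →⋆ₙₐ[ℂ] A) (a : Matrix ℕ ℕ A) : Matrix ℕ ℕ A :=
  fun i j => if 0 < i ∧ 0 < j then α (a (i - 1) (j - 1)) else 0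

/-- The entrywise finite sum `∑_{j ≥ s} Λ^j(a)`. -/
noncomputable def lamSum (α : A →⋆ₙₐ[ℂ] A) (s : ℕ) (a : Matrix ℕ ℕ A) : Matrix ℕ ℕ A :=
  fun m n => ∑ᶠ j : ℕ, ((Lam α)^[s + j] a) m n

/-- The convolution product `a ⋆ b = a · ∑_{j ≥ 0} Λ^j(b) + ∑_{j ≥ 1} Λ^j(a) · b`. -/
noncomputable def convMul (α : A →⋆ₙₐ[ℂ] A) (a b : Matrix ℕ ℕ A) : Matrix ℕ ℕ A :=
  infMul a (lamSum α 0 b) + infMul (lamSum α 1 a) b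

/-- The infinite matrices with finitely many nonzero entries, the entry at `(i, j)` lying
in `α^i(1) A α^j(1)`. -/
def matSubmodule (α : A →⋆ₙₐ[ℂ] A) : Submodule ℂ (Matrix ℕ ℕ A) where
  carrier := {a | {p : ℕ × ℕ | a p.1 p.2 ≠ 0}.Finite ∧
    ∀ i j, ∃ x : A, a i j = α^[i] 1 * x * α^[j] 1}
  zero_mem' := ⟨by simp, fun i j => ⟨0, by simp⟩⟩
  add_mem' := by
    rintro a b ⟨ha, ha'⟩ ⟨hb, hb'⟩
    refine ⟨(ha.union hb).subset ?_, fun i j => ?_⟩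
    · rintro p hp
      by_contra h
      simp only [Set.mem_union, Set.mem_ofPred_eq, not_or, not_not] at h
      exact hp (by simp [h.1, h.2])
    · obtain ⟨x, hx⟩ := ha' i j
      obtain ⟨y, hy⟩ := hb' i j
      exact ⟨x + y, by simp [hx, hy, mul_add, add_mul]⟩
  smul_mem' := by
    rintro c a ⟨ha, ha'⟩
    refine ⟨ha.subset ?_, fun i j => ?_⟩
    · rintro p hp h
      exact hp (by simp [h])
    · obtain ⟨x, hx⟩ := ha' i j
      exact ⟨c • x, by simp [hx]⟩

/-- The `*`-algebra of matrices attached to `(A, α)`; its multiplication is `convMul`. -/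
def MatAlg (α : A →⋆ₙₐ[ℂ] A) : Type u := matSubmodule α

variable {α : A →⋆ₙₐ[ℂ] A}

noncomputable instance : AddCommGroup (MatAlg α) :=
  inferInstanceAs (AddCommGroup (matSubmodule α))

noncomputable instance : Module ℂ (MatAlg α) :=
  inferInstanceAs (Module ℂ (matSubmodule α))

/-- The underlying matrix. -/
def MatAlg.val (a : MatAlg α) : Matrix ℕ ℕ A := Subtype.val a

theorem MatAlg.ext {a b : MatAlg α} (h : a.val = b.val) : a = b := Subtype.ext h

theorem MatAlg.val_add (a b : MatAlg α) : (a + b).val = a.val + b.val := rfl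
theorem MatAlg.val_sub (a b : MatAlg α) : (a - b).val = a.val - b.val := rfl
theorem MatAlg.val_neg (a : MatAlg α) : (-a).val = -a.val := rfl
theorem MatAlg.val_zero : (0 : MatAlg α).val = 0 := rfl
theorem MatAlg.val_smul (c : ℂ) (a : MatAlg α) : (c • a).val = c • a.val := rfl

theorem MatAlg.exists_bound (a : MatAlg α) :
    ∃ N : ℕ, ∀ m n, (N ≤ m ∨ N ≤ n) → a.val m n = 0 := by
  obtain ⟨B, hB⟩ := (a.2.1.image Prod.fst).bddAbove
  obtain ⟨C, hC⟩ := (a.2.1.image Prod.snd).bddAbove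
  refine ⟨max B C + 1, fun m n h => ?_⟩
  by_contra hne
  have h1 : m ≤ B := hB ⟨(m, n), hne, rfl⟩
  have h2 : n ≤ C := hC ⟨(m, n), hne, rfl⟩
  omega

theorem finite_of_bound {x : Matrix ℕ ℕ A} {N : ℕ}
    (h : ∀ m n, (N ≤ m ∨ N ≤ n) → x m n = 0) : {p : ℕ × ℕ | x p.1 p.2 ≠ 0}.Finite := by
  refine (((Set.finite_Iio N).prod (Set.finite_Iio N))).subset ?_
  rintro ⟨m, n⟩ hp
  simp only [Set.mem_prod, Set.mem_Iio]
  by_contra hc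
  exact hp (h m n (by omega))

/-! ### Calculus of row-finite matrices -/

/-- Row-finiteness. -/
def RowFin (x : Matrix ℕ ℕ A) : Prop := ∀ m, ∃ K : ℕ, ∀ k, K ≤ k → x m k = 0

theorem infMul_eq_sum {x : Matrix ℕ ℕ A} (y : Matrix ℕ ℕ A) {m K : ℕ}
    (h : ∀ k, K ≤ k → x m k = 0) (n : ℕ) :
    infMul x y m n = ∑ k ∈ Finset.range K, x m k * y k n := by
  refine finsum_eq_sum_of_support_subset _ fun k hk => ?_
  simp only [Finset.coe_range, Set.mem_Iio]
  by_contra hc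
  exact hk (by simp [h k (by omega)])

theorem RowFin.add {x y : Matrix ℕ ℕ A} (hx : RowFin x) (hy : RowFin y) : RowFin (x + y) := by
  intro m
  obtain ⟨K, hK⟩ := hx m
  obtain ⟨L, hL⟩ := hy m
  exact ⟨max K L, fun k hk => by
    simp [hK k (by omega), hL k (by omega)]⟩

theorem RowFin.infMul {x y : Matrix ℕ ℕ A} (hx : RowFin x) (hy : RowFin y) :
    RowFin (infMul x y) := by
  intro m
  obtain ⟨K, hK⟩ := hx m
  choose L hL using hy
  refine ⟨(Finset.range K).sup L, fun n hn => ?_⟩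
  rw [infMul_eq_sum y hK]
  refine Finset.sum_eq_zero fun k hk => ?_
  rw [hL k n ((Finset.le_sup (f := L) hk).trans hn), mul_zero]

theorem infMul_add_left {x x' : Matrix ℕ ℕ A} (hx : RowFin x) (hx' : RowFin x')
    (y : Matrix ℕ ℕ A) : infMul (x + x') y = infMul x y + infMul x' y := by
  ext m n
  obtain ⟨K, hK⟩ := hx m
  obtain ⟨L, hL⟩ := hx' m
  have h1 : ∀ k, max K L ≤ k → x m k = 0 := fun k hk => hK k (by omega)
  have h2 : ∀ k, max K L ≤ k → x' m k = 0 := fun k hk => hL k (by omega)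
  rw [Matrix.add_apply, infMul_eq_sum y h1, infMul_eq_sum y h2,
    infMul_eq_sum (x := x + x') (K := max K L) y (fun k hk => by simp [h1 k hk, h2 k hk]),
    ← Finset.sum_add_distrib]
  simp [add_mul]

theorem infMul_add_right {x : Matrix ℕ ℕ A} (hx : RowFin x)
    (y y' : Matrix ℕ ℕ A) : infMul x (y + y') = infMul x y + infMul x y' := by
  ext m n
  obtain ⟨K, hK⟩ := hx m
  rw [Matrix.add_apply, infMul_eq_sum y hK, infMul_eq_sum y' hK, infMul_eq_sum _ hK,
    ← Finset.sum_add_distrib]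
  simp [mul_add]

theorem infMul_assoc {x y : Matrix ℕ ℕ A} (hx : RowFin x) (hy : RowFin y)
    (z : Matrix ℕ ℕ A) : infMul (infMul x y) z = infMul x (infMul y z) := by
  ext m n
  obtain ⟨K, hK⟩ := hx m
  choose L hL using hy
  have hM : ∀ k < K, ∀ l, (Finset.range K).sup L ≤ l → y k l = 0 := fun k hk l hl =>
    hL k l ((Finset.le_sup (f := L) (Finset.mem_range.2 hk)).trans hl)
  have hxy : ∀ l, (Finset.range K).sup L ≤ l → infMul x y m l = 0 := fun l hl => by
    rw [infMul_eq_sum y hK]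
    exact Finset.sum_eq_zero fun k hk => by rw [hM k (Finset.mem_range.1 hk) l hl, mul_zero]
  rw [infMul_eq_sum z hxy, infMul_eq_sum _ hK]
  simp_rw [infMul_eq_sum y hK, Finset.sum_mul]
  rw [Finset.sum_comm]
  refine Finset.sum_congr rfl fun k hk => ?_
  rw [infMul_eq_sum z (hM k (Finset.mem_range.1 hk)), Finset.mul_sum]
  exact Finset.sum_congr rfl fun l _ => by rw [mul_assoc]

theorem infMul_smul_left (c : ℂ) (x y : Matrix ℕ ℕ A) :
    infMul (c • x) y = c • infMul x y := by
  ext m n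
  simp [infMul, smul_finsum]

theorem infMul_smul_right (c : ℂ) (x y : Matrix ℕ ℕ A) :
    infMul x (c • y) = c • infMul x y := by
  ext m n
  simp [infMul, smul_finsum]

theorem infMul_star (x y : Matrix ℕ ℕ A) :
    (infMul x y).conjTranspose = infMul y.conjTranspose x.conjTranspose := by
  ext m n
  simp only [infMul, Matrix.conjTranspose_apply]
  have := AddEquiv.map_finsum (starAddEquiv (R := A)) (fun k => x n k * y k m)
  refine Eq.trans this (finsum_congr fun k => ?_)
  exact star_mul _ _

/-! ### The shift -/

theorem Lam_zero_left (a : Matrix ℕ ℕ A) (n : ℕ) : Lam α a 0 n = 0 := by simp [Lam]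
theorem Lam_zero_right (a : Matrix ℕ ℕ A) (m : ℕ) : Lam α a m 0 = 0 := by simp [Lam]
theorem Lam_succ (a : Matrix ℕ ℕ A) (m n : ℕ) : Lam α a (m + 1) (n + 1) = α (a m n) := by
  simp [Lam]

theorem Lam_ext {x y : Matrix ℕ ℕ A} (h0 : ∀ n, x 0 n = y 0 n) (h1 : ∀ m, x m 0 = y m 0)
    (h : ∀ m n, x (m + 1) (n + 1) = y (m + 1) (n + 1)) : x = y := by
  ext m n
  cases m with
  | zero => exact h0 n
  | succ m =>
    cases n with
    | zero => exact h1 _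
    | succ n => exact h m n

theorem Lam_add (x y : Matrix ℕ ℕ A) : Lam α (x + y) = Lam α x + Lam α y := by
  refine Lam_ext ?_ ?_ ?_ <;> simp [Lam_zero_left, Lam_zero_right, Lam_succ]

theorem Lam_smul (c : ℂ) (x : Matrix ℕ ℕ A) : Lam α (c • x) = c • Lam α x := by
  refine Lam_ext ?_ ?_ ?_ <;> simp [Lam_zero_left, Lam_zero_right, Lam_succ]

theorem Lam_star (x : Matrix ℕ ℕ A) : Lam α x.conjTranspose = (Lam α x).conjTranspose := by
  refine Lam_ext ?_ ?_ ?_ <;> simp [Lam_zero_left, Lam_zero_right, Lam_succ, map_star]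

theorem RowFin.Lam {x : Matrix ℕ ℕ A} (hx : RowFin x) : RowFin (Lam α x) := by
  rintro (_ | m)
  · exact ⟨0, fun k _ => Lam_zero_left _ _⟩
  · obtain ⟨K, hK⟩ := hx m
    refine ⟨K + 1, fun k hk => ?_⟩
    obtain ⟨k, rfl⟩ : ∃ l, k = l + 1 := ⟨k - 1, by omega⟩
    rw [Lam_succ, hK k (by omega), map_zero]

theorem Lam_infMul {x : Matrix ℕ ℕ A} (hx : RowFin x) (y : Matrix ℕ ℕ A) :
    Lam α (infMul x y) = infMul (Lam α x) (Lam α y) := by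
  refine Lam_ext (fun n => ?_) (fun m => ?_) (fun m n => ?_)
  · simp [infMul, Lam_zero_left]
  · simp [infMul, Lam_zero_right]
  · obtain ⟨K, hK⟩ := hx m
    have hK' : ∀ k, K + 1 ≤ k → Lam α x (m + 1) k = 0 := fun k hk => by
      obtain ⟨k, rfl⟩ : ∃ l, k = l + 1 := ⟨k - 1, by omega⟩
      rw [Lam_succ, hK k (by omega), map_zero]
    rw [Lam_succ, infMul_eq_sum y hK, infMul_eq_sum _ hK', Finset.sum_range_succ']
    simp [Lam_succ, Lam_zero_right, map_sum]

/-- A matrix solving `x = c + Λ(x)` is determined by `c`. -/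
theorem Lam_unique {x y c : Matrix ℕ ℕ A} (hx : x = c + Lam α x) (hy : y = c + Lam α y) :
    x = y := by
  ext m n
  induction m generalizing n with
  | zero => rw [hx, hy]; simp [Lam_zero_left]
  | succ m ih =>
    cases n with
    | zero => rw [hx, hy]; simp [Lam_zero_right]
    | succ n => rw [hx, hy]; simp [Lam_succ, ih]

theorem Lam_iterate_eq_zero (a : Matrix ℕ ℕ A) {j m : ℕ} (h : m < j) (n : ℕ) :
    ((Lam α)^[j] a) m n = 0 := by
  induction j generalizing m n with
  | zero => omega
  | succ j ih =>
    rw [Function.iterate_succ_apply']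
    cases m with
    | zero => exact Lam_zero_left _ _
    | succ m =>
      cases n with
      | zero => exact Lam_zero_right _ _
      | succ n => rw [Lam_succ, ih (by omega), map_zero]

theorem lamSum_eq_sum (s : ℕ) (a : Matrix ℕ ℕ A) {m K : ℕ} (hK : m < K) (n : ℕ) :
    lamSum α s a m n = ∑ j ∈ Finset.range K, ((Lam α)^[s + j] a) m n := by
  refine finsum_eq_sum_of_support_subset _ fun k hk => ?_
  simp only [Finset.coe_range, Set.mem_Iio]
  by_contra hc
  exact hk (Lam_iterate_eq_zero a (by omega) n)

theorem lamSum_one (a : Matrix ℕ ℕ A) : lamSum α 1 a = Lam α (lamSum α 0 a) := by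
  refine Lam_ext (fun n => ?_) (fun m => ?_) (fun m n => ?_)
  · simp [lamSum, Nat.add_comm 1, Function.iterate_succ_apply', Lam_zero_left]
  · simp [lamSum, Nat.add_comm 1, Function.iterate_succ_apply', Lam_zero_right]
  · rw [Lam_succ, lamSum_eq_sum 1 a (Nat.lt_succ_self _),
      lamSum_eq_sum 0 a (K := m + 1 + 1) (by omega), map_sum]
    simp [Nat.add_comm 1, Function.iterate_succ_apply', Lam_succ]

theorem lamSum_zero (a : Matrix ℕ ℕ A) : lamSum α 0 a = a + Lam α (lamSum α 0 a) := by
  rw [← lamSum_one]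
  ext m n
  rw [Matrix.add_apply, lamSum_eq_sum 0 a (K := m + 1 + 1) (by omega),
    lamSum_eq_sum 1 a (K := m + 1) (by omega), Finset.sum_range_succ', add_comm]
  simp [Nat.add_comm 1]

theorem lamSum_eq_of {x c : Matrix ℕ ℕ A} (hx : x = c + Lam α x) : lamSum α 0 c = x :=
  Lam_unique (lamSum_zero c) hx

theorem lamSum_injective {a b : Matrix ℕ ℕ A} (h : lamSum α 0 a = lamSum α 0 b) : a = b := by
  have h1 := lamSum_zero (α := α) a
  have h2 := lamSum_zero (α := α) b
  rw [h] at h1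
  exact add_right_cancel (h1.symm.trans h2)

theorem lamSum_add (a b : Matrix ℕ ℕ A) :
    lamSum α 0 (a + b) = lamSum α 0 a + lamSum α 0 b := by
  refine lamSum_eq_of ?_
  rw [Lam_add]
  conv_lhs => rw [lamSum_zero a, lamSum_zero b]
  abel

theorem lamSum_smul (c : ℂ) (a : Matrix ℕ ℕ A) :
    lamSum α 0 (c • a) = c • lamSum α 0 a := by
  refine lamSum_eq_of ?_
  rw [Lam_smul]
  conv_lhs => rw [lamSum_zero a]
  rw [smul_add]

theorem lamSum_star (a : Matrix ℕ ℕ A) :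
    lamSum α 0 a.conjTranspose = (lamSum α 0 a).conjTranspose := by
  refine lamSum_eq_of ?_
  rw [Lam_star]
  conv_lhs => rw [lamSum_zero a]
  rw [Matrix.conjTranspose_add]

theorem lamSum_band {a : Matrix ℕ ℕ A} {N : ℕ}
    (h : ∀ m n, (N ≤ m ∨ N ≤ n) → a m n = 0) (m n : ℕ) (hmn : m + N ≤ n ∨ n + N ≤ m) :
    lamSum α 0 a m n = 0 := by
  induction m generalizing n with
  | zero => rw [lamSum_zero, Matrix.add_apply, Lam_zero_left, h _ _ (by omega), add_zero]
  | succ m ih =>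
    cases n with
    | zero => rw [lamSum_zero, Matrix.add_apply, Lam_zero_right, h _ _ (by omega), add_zero]
    | succ n =>
      rw [lamSum_zero, Matrix.add_apply, Lam_succ, h _ _ (by omega), ih _ (by omega),
        map_zero, add_zero]

theorem rowFin_of_bound {a : Matrix ℕ ℕ A} {N : ℕ}
    (h : ∀ m n, (N ≤ m ∨ N ≤ n) → a m n = 0) : RowFin a :=
  fun m => ⟨N, fun k hk => h m k (Or.inr hk)⟩

theorem rowFin_lamSum {a : Matrix ℕ ℕ A} {N : ℕ}
    (h : ∀ m n, (N ≤ m ∨ N ≤ n) → a m n = 0) : RowFin (lamSum α 0 a) :=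
  fun m => ⟨m + N, fun k hk => lamSum_band h m k (Or.inl hk)⟩

/-- `∑_{j ≥ 0} Λ^j` turns the convolution product into the standard product. -/
theorem lamSum_convMul {a b : Matrix ℕ ℕ A} {N : ℕ}
    (ha : ∀ m n, (N ≤ m ∨ N ≤ n) → a m n = 0) :
    lamSum α 0 (convMul α a b) = infMul (lamSum α 0 a) (lamSum α 0 b) := by
  refine lamSum_eq_of ?_
  have hE := rowFin_lamSum (α := α) ha
  rw [Lam_infMul hE, convMul, add_assoc, lamSum_one, ← infMul_add_right hE.Lam, ← lamSum_zero,
    ← infMul_add_left (rowFin_of_bound ha) hE.Lam, ← lamSum_zero]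

/-! ### Corners -/

theorem iter_mul (i : ℕ) (x y : A) : α^[i] (x * y) = α^[i] x * α^[i] y := by
  induction i generalizing x y with
  | zero => rfl
  | succ i ih => simp [Function.iterate_succ_apply, ih]

theorem iter_star (i : ℕ) (x : A) : α^[i] (star x) = star (α^[i] x) := by
  induction i generalizing x with
  | zero => rfl
  | succ i ih => simp [Function.iterate_succ_apply, map_star, ih]

theorem iter_one_mul_self (i : ℕ) : α^[i] 1 * α^[i] (1 : A) = α^[i] 1 := by
  rw [← iter_mul, mul_one]

theorem iter_one_star (i : ℕ) : star (α^[i] (1 : A)) = α^[i] 1 := by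
  rw [← iter_star, star_one]

/-- All entries lie in the corners `α^i(1) A α^j(1)`. -/
def Corner (α : A →⋆ₙₐ[ℂ] A) (x : Matrix ℕ ℕ A) : Prop :=
  ∀ i j, ∃ y : A, x i j = α^[i] 1 * y * α^[j] 1

theorem corner_iff {x : Matrix ℕ ℕ A} :
    Corner α x ↔ ∀ i j, α^[i] 1 * x i j = x i j ∧ x i j * α^[j] 1 = x i j := by
  constructor
  · intro h i j
    obtain ⟨y, hy⟩ := h i j
    rw [hy]
    refine ⟨?_, ?_⟩
    · rw [← mul_assoc, ← mul_assoc, iter_one_mul_self]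
    · rw [mul_assoc, iter_one_mul_self]
  · intro h i j
    exact ⟨x i j, by rw [(h i j).1, (h i j).2]⟩

theorem Corner.lamSum {a : Matrix ℕ ℕ A} (h : Corner α a) : Corner α (lamSum α 0 a) := by
  intro m n
  induction m generalizing n with
  | zero => rw [lamSum_zero, Matrix.add_apply, Lam_zero_left, add_zero]; exact h _ _
  | succ m ih =>
    cases n with
    | zero => rw [lamSum_zero, Matrix.add_apply, Lam_zero_right, add_zero]; exact h _ _
    | succ n =>
      rw [lamSum_zero, Matrix.add_apply, Lam_succ]
      obtain ⟨y, hy⟩ := h (m + 1) (n + 1)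
      obtain ⟨z, hz⟩ := ih n
      refine ⟨y + α z, ?_⟩
      rw [hy, hz, map_mul, map_mul, ← Function.iterate_succ_apply' α,
        ← Function.iterate_succ_apply' α, mul_add, add_mul]

theorem Corner.sub {x y : Matrix ℕ ℕ A} (hx : Corner α x) (hy : Corner α y) :
    Corner α (x - y) := by
  rw [corner_iff] at *
  intro i j
  simp [mul_sub, sub_mul, hx i j, hy i j]

theorem Corner.add {x y : Matrix ℕ ℕ A} (hx : Corner α x) (hy : Corner α y) :
    Corner α (x + y) := by
  rw [corner_iff] at *
  intro i j
  simp [mul_add, add_mul, hx i j, hy i j]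

theorem Corner.infMul {x y : Matrix ℕ ℕ A} (hx : Corner α x) (hy : Corner α y)
    (hxr : RowFin x) : Corner α (infMul x y) := by
  rw [corner_iff] at *
  intro i j
  obtain ⟨K, hK⟩ := hxr i
  rw [infMul_eq_sum y hK, Finset.mul_sum, Finset.sum_mul]
  refine ⟨Finset.sum_congr rfl fun k _ => ?_, Finset.sum_congr rfl fun k _ => ?_⟩
  · rw [← mul_assoc, (hx i k).1]
  · rw [mul_assoc, (hy k j).2]

theorem Corner.lamSum_one {a : Matrix ℕ ℕ A} (h : Corner α a) :
    Corner α (EndoCrossed.lamSum α 1 a) := by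
  have h2 : EndoCrossed.lamSum α 1 a = EndoCrossed.lamSum α 0 a - a := by
    rw [EndoCrossed.lamSum_one, eq_sub_iff_add_eq', ← lamSum_zero]
  rw [h2]
  exact h.lamSum.sub h

theorem convMul_bound {a b : Matrix ℕ ℕ A} {N : ℕ}
    (ha : ∀ m n, (N ≤ m ∨ N ≤ n) → a m n = 0) (hb : ∀ m n, (N ≤ m ∨ N ≤ n) → b m n = 0)
    (m n : ℕ) (h : 2 * N ≤ m ∨ 2 * N ≤ n) : convMul α a b m n = 0 := by
  have e1 : infMul a (lamSum α 0 b) m n = 0 := by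
    rw [infMul]
    refine finsum_eq_zero_of_forall_eq_zero fun k => ?_
    by_cases h1 : N ≤ m ∨ N ≤ k
    · rw [ha m k h1, zero_mul]
    · rw [lamSum_band hb k n (by omega), mul_zero]
  have e2 : infMul (lamSum α 1 a) b m n = 0 := by
    rw [infMul]
    refine finsum_eq_zero_of_forall_eq_zero fun k => ?_
    by_cases h1 : N ≤ k ∨ N ≤ n
    · rw [hb k n h1, mul_zero]
    · have h3 : lamSum α 0 a m k = 0 := lamSum_band ha m k (by omega)
      have h2 : lamSum α 1 a m k = 0 := by
        have h4 := congrFun (congrFun (lamSum_zero (α := α) a) m) k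
        rw [Matrix.add_apply, h3, ha m k (by omega), zero_add] at h4
        rw [lamSum_one, ← h4]
      rw [h2, zero_mul]
  rw [convMul, Matrix.add_apply, e1, e2, add_zero]

theorem exists_common_bound (a b : MatAlg α) : ∃ N : ℕ,
    (∀ m n, (N ≤ m ∨ N ≤ n) → a.val m n = 0) ∧ (∀ m n, (N ≤ m ∨ N ≤ n) → b.val m n = 0) := by
  obtain ⟨N, hN⟩ := a.exists_bound
  obtain ⟨M, hM⟩ := b.exists_bound
  exact ⟨max N M, fun m n h => hN m n (by omega), fun m n h => hM m n (by omega)⟩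

theorem convMul_mem (a b : MatAlg α) : convMul α a.val b.val ∈ matSubmodule α := by
  obtain ⟨N, ha, hb⟩ := exists_common_bound a b
  have ca : Corner α a.val := a.2.2
  have cb : Corner α b.val := b.2.2
  refine ⟨finite_of_bound (convMul_bound ha hb), ?_⟩
  refine (ca.infMul cb.lamSum (rowFin_of_bound ha)).add (ca.lamSum_one.infMul cb ?_)
  rw [lamSum_one]
  exact (rowFin_lamSum ha).Lam

noncomputable instance : Mul (MatAlg α) := ⟨fun a b => ⟨convMul α a.val b.val, convMul_mem a b⟩⟩

theorem MatAlg.val_mul (a b : MatAlg α) : (a * b).val = convMul α a.val b.val := rfl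

/-- The involution `(a*) m n = (a n m)*`. -/
noncomputable instance : Star (MatAlg α) :=
  ⟨fun a => ⟨a.val.conjTranspose, by
    obtain ⟨N, hN⟩ := a.exists_bound
    refine ⟨finite_of_bound (N := N) fun m n h => ?_, fun i j => ?_⟩
    · rw [Matrix.conjTranspose_apply, hN n m (by omega), star_zero]
    · obtain ⟨x, hx⟩ := a.2.2 j i
      refine ⟨star x, ?_⟩
      have hx' : a.val j i = α^[j] 1 * x * α^[i] 1 := hx
      rw [Matrix.conjTranspose_apply, hx', star_mul, star_mul, iter_one_star, iter_one_star,
        mul_assoc]⟩⟩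

theorem MatAlg.val_star (a : MatAlg α) : (star a).val = a.val.conjTranspose := rfl

/-- The matrix whose only (possibly) nonzero entry is `x`, at `(i, j)`. -/
def single (i j : ℕ) (x : A) : Matrix ℕ ℕ A := fun m n => if m = i ∧ n = j then x else 0

theorem single_bound (i j : ℕ) (x : A) (m n : ℕ) (h : i + j + 1 ≤ m ∨ i + j + 1 ≤ n) :
    single i j x m n = 0 := by
  simp only [single, ite_eq_right_iff]
  omega

theorem single_mem {i j : ℕ} {x : A} (h : ∃ y, x = α^[i] 1 * y * α^[j] 1) :
    single i j x ∈ matSubmodule α := by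
  refine ⟨finite_of_bound (single_bound i j x), fun m n => ?_⟩
  by_cases hmn : m = i ∧ n = j
  · obtain ⟨rfl, rfl⟩ := hmn
    simpa [single] using h
  · exact ⟨0, by simp [single, hmn]⟩

/-- The embedding of `A` into the matrix algebra: `a` is placed at `(0, 0)`. -/
noncomputable def MatAlg.of (α : A →⋆ₙₐ[ℂ] A) (a : A) : MatAlg α :=
  ⟨single 0 0 a, single_mem ⟨a, by simp⟩⟩

/-- The element `u`: the matrix with `α(1)` at `(0, 1)` and zeros elsewhere. -/
noncomputable def MatAlg.u (α : A →⋆ₙₐ[ℂ] A) : MatAlg α :=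
  ⟨single 0 1 (α 1), single_mem ⟨α 1, by simp [← map_mul]⟩⟩

noncomputable instance : One (MatAlg α) := ⟨MatAlg.of α 1⟩

/-- The injective map `∑_{j ≥ 0} Λ^j` on the matrix algebra. -/
noncomputable def MatAlg.ev (a : MatAlg α) : Matrix ℕ ℕ A := lamSum α 0 a.val

theorem MatAlg.ev_injective {a b : MatAlg α} (h : a.ev = b.ev) : a = b :=
  MatAlg.ext (lamSum_injective h)

theorem MatAlg.ev_add (a b : MatAlg α) : (a + b).ev = a.ev + b.ev := lamSum_add _ _

theorem MatAlg.ev_smul (c : ℂ) (a : MatAlg α) : (c • a).ev = c • a.ev := lamSum_smul _ _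

theorem MatAlg.ev_star (a : MatAlg α) : (star a).ev = a.ev.conjTranspose := lamSum_star _

theorem MatAlg.ev_mul (a b : MatAlg α) : (a * b).ev = infMul a.ev b.ev := by
  obtain ⟨N, hN⟩ := a.exists_bound
  exact lamSum_convMul hN

theorem MatAlg.ev_rowFin (a : MatAlg α) : RowFin a.ev := by
  obtain ⟨N, hN⟩ := a.exists_bound
  exact rowFin_lamSum hN

theorem MatAlg.ev_zero : (0 : MatAlg α).ev = 0 := by
  have := MatAlg.ev_smul (0 : ℂ) (0 : MatAlg α)
  simpa using this

/-- The diagonal matrix with entries `α^m(1)`. -/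
noncomputable def diagOne (α : A →⋆ₙₐ[ℂ] A) : Matrix ℕ ℕ A :=
  fun m n => if m = n then α^[m] 1 else 0

theorem MatAlg.ev_one (m n : ℕ) :
    (1 : MatAlg α).ev m n = if m = n then α^[m] 1 else 0 := by
  have : (1 : MatAlg α).ev = diagOne α := by
    refine lamSum_eq_of (α := α) (c := single 0 0 1) ?_
    refine Lam_ext (fun n => ?_) (fun m => ?_) (fun m n => ?_)
    · simp [Lam_zero_left, single, diagOne, eq_comm]
    · rcases m with _ | m <;> simp [Lam_zero_right, single, diagOne]
    · by_cases h : m = n <;>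
        simp [h, Lam_succ, single, diagOne, ← Function.iterate_succ_apply' α]
  rw [this]
  rfl

theorem MatAlg.ev_corner (a : MatAlg α) : Corner α a.ev := Corner.lamSum (a := a.val) a.2.2

noncomputable instance : Ring (MatAlg α) where
  __ := (inferInstance : AddCommGroup (MatAlg α))
  left_distrib a b c := MatAlg.ev_injective <| by
    simp only [MatAlg.ev_mul, MatAlg.ev_add, infMul_add_right a.ev_rowFin]
  right_distrib a b c := MatAlg.ev_injective <| by
    simp only [MatAlg.ev_mul, MatAlg.ev_add, infMul_add_left a.ev_rowFin b.ev_rowFin]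
  zero_mul a := MatAlg.ev_injective <| by
    rw [MatAlg.ev_mul, MatAlg.ev_zero]
    ext m n
    simp [infMul]
  mul_zero a := MatAlg.ev_injective <| by
    rw [MatAlg.ev_mul, MatAlg.ev_zero]
    ext m n
    simp [infMul]
  mul_assoc a b c := MatAlg.ev_injective <| by
    simp only [MatAlg.ev_mul, infMul_assoc a.ev_rowFin b.ev_rowFin]
  one_mul a := MatAlg.ev_injective <| by
    rw [MatAlg.ev_mul]
    ext m n
    rw [infMul, finsum_eq_single _ m (fun k hk => by rw [MatAlg.ev_one, if_neg hk.symm, zero_mul]),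
      MatAlg.ev_one, if_pos rfl, (corner_iff.1 a.ev_corner m n).1]
  mul_one a := MatAlg.ev_injective <| by
    rw [MatAlg.ev_mul]
    ext m n
    rw [infMul, finsum_eq_single _ n (fun k hk => by rw [MatAlg.ev_one, if_neg hk, mul_zero]),
      MatAlg.ev_one, if_pos rfl, (corner_iff.1 a.ev_corner m n).2]

noncomputable instance : Algebra ℂ (MatAlg α) := Algebra.ofModule
  (fun c a b => MatAlg.ev_injective <| by
    simp only [MatAlg.ev_mul, MatAlg.ev_smul, infMul_smul_left])
  (fun c a b => MatAlg.ev_injective <| by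
    simp only [MatAlg.ev_mul, MatAlg.ev_smul, infMul_smul_right])

noncomputable instance : StarRing (MatAlg α) where
  star_involutive a := MatAlg.ext <| by simp [MatAlg.val_star]
  star_mul a b := MatAlg.ev_injective <| by
    simp only [MatAlg.ev_mul, MatAlg.ev_star, infMul_star]
  star_add a b := MatAlg.ext <| by simp [MatAlg.val_star, MatAlg.val_add]

noncomputable instance : StarModule ℂ (MatAlg α) where
  star_smul c a := MatAlg.ext <| by
    simp [MatAlg.val_star, MatAlg.val_smul, Matrix.conjTranspose_smul]

end MatrixAlgebra

section Seminorm

variable {A : Type u} [CStarAlgebra A] {α : A →⋆ₙₐ[ℂ] A}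

/-- The entries `a_n^{(k)}` of the `k`-th diagonal: `a_n^{(k)} = a_{n, n+k}` for `k ≥ 0`
and `a_n^{(k)} = a_{n-k, n}` for `k < 0`. -/
def MatAlg.diag (a : MatAlg α) (k : ℤ) (n : ℕ) : A := a.val (n + (-k).toNat) (n + k.toNat)

/-- `∑_{j = 0}^{i} α^{i-j}(a_j^{(k)})`. -/
noncomputable def MatAlg.diagSum (a : MatAlg α) (k : ℤ) (i : ℕ) : A :=
  ∑ j ∈ Finset.range (i + 1), α^[i - j] (a.diag k j)

/-- `max { max_{0 ≤ i ≤ n} d(∑_{j ≤ i} α^{i-j}(a_j^{(k)}), J), d(∑_{j ≤ n} α^{n-j}(a_j^{(k)}), ker α) }`. -/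
noncomputable def MatAlg.diagDist (J : TwoSidedIdeal A) (a : MatAlg α) (k : ℤ) (n : ℕ) : ℝ :=
  max ((Finset.range (n + 1)).sup' Finset.nonempty_range_add_one
      fun i => Metric.infDist (a.diagSum k i) (J : Set A))
    (Metric.infDist (a.diagSum k n) {x : A | α x = 0})

/-- The seminorm `|||a|||_J`. All its limits exist, see `MatAlg.tendsto_diagDist`, and only
finitely many summands are nonzero. -/
noncomputable def MatAlg.seminorm (J : TwoSidedIdeal A) (a : MatAlg α) : ℝ :=
  ∑ᶠ k : ℤ, limUnder atTop (a.diagDist J k)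

theorem star_mem_closure (J : TwoSidedIdeal A) {x : A} (hx : x ∈ J) :
    star x ∈ closure (J : Set A) := by
  refine Metric.mem_closure_iff.2 fun δ' hδ' => ?_
  obtain ⟨δ, hδ, hδδ⟩ : ∃ δ : ℝ, 0 < δ ∧ δ < δ' ^ 2 := exists_between (by positivity)
  set h : A := x * star x with hh
  have hsa : IsSelfAdjoint h := IsSelfAdjoint.mul_star_self x
  have hpos : ∀ t : ℝ, 0 < t ^ 2 + δ ^ 2 := fun t => by positivity
  have hc : Continuous fun t : ℝ => t / (t ^ 2 + δ ^ 2) :=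
    continuous_id.div (by fun_prop) fun t => (hpos t).ne'
  have hc1 : Continuous fun t : ℝ => δ ^ 2 / (t ^ 2 + δ ^ 2) :=
    continuous_const.div (by fun_prop) fun t => (hpos t).ne'
  set g : A := cfc (fun t : ℝ => t / (t ^ 2 + δ ^ 2)) h with hg
  have hcm : Continuous fun t : ℝ => t * (t / (t ^ 2 + δ ^ 2)) := continuous_id.mul hc
  have hw : (1 : A) - h * g = cfc (fun t : ℝ => δ ^ 2 / (t ^ 2 + δ ^ 2)) h := by
    have h1 : h = cfc (fun t : ℝ => t) h := (cfc_id' ℝ h).symm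
    have h2 : h * g = cfc (fun t : ℝ => t * (t / (t ^ 2 + δ ^ 2))) h := by
      rw [cfc_mul (fun t : ℝ => t) (fun t : ℝ => t / (t ^ 2 + δ ^ 2)) h (by fun_prop)
        hc.continuousOn, ← h1]
    rw [h2, ← cfc_one ℝ h, ← cfc_sub (1 : ℝ → ℝ) _ h (by fun_prop)
      hcm.continuousOn]
    refine cfc_congr fun t _ => ?_
    have := (hpos t).ne'
    simp only [Pi.one_apply]
    field_simp
    ring
  have hwsa : IsSelfAdjoint (1 - h * g) := by rw [hw]; exact cfc_predicate _ _
  refine ⟨star x * (h * g), J.mul_mem_left _ _ (J.mul_mem_right _ _ (J.mul_mem_right _ _ hx)), ?_⟩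
  have e : star x - star x * (h * g) = star x * (1 - h * g) := by rw [mul_sub, mul_one]
  rw [dist_eq_norm, e]
  have e2 : star (star x * (1 - h * g)) * (star x * (1 - h * g))
      = cfc (fun t : ℝ => δ ^ 2 / (t ^ 2 + δ ^ 2) * t * (δ ^ 2 / (t ^ 2 + δ ^ 2))) h := by
    have h1 : h = cfc (fun t : ℝ => t) h := (cfc_id' ℝ h).symm
    rw [cfc_mul (fun t : ℝ => δ ^ 2 / (t ^ 2 + δ ^ 2) * t) _ h
      (hc1.mul continuous_id).continuousOn hc1.continuousOn,
      cfc_mul _ (fun t : ℝ => t) h hc1.continuousOn (by fun_prop), ← h1, ← hw, star_mul,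
      hwsa.star_eq, star_star, hh]
    simp only [mul_assoc]
  have e3 : ‖star x * (1 - h * g)‖ * ‖star x * (1 - h * g)‖ ≤ δ := by
    rw [← CStarRing.norm_star_mul_self, e2]
    refine norm_cfc_le hδ.le fun t _ => ?_
    have hp := hpos t
    have e4 : δ ^ 2 / (t ^ 2 + δ ^ 2) * t * (δ ^ 2 / (t ^ 2 + δ ^ 2))
        = (δ ^ 2 / (t ^ 2 + δ ^ 2)) * (δ ^ 2 * t / (t ^ 2 + δ ^ 2)) := by ring
    rw [e4, norm_mul]
    have e5 : ‖δ ^ 2 / (t ^ 2 + δ ^ 2)‖ ≤ 1 := by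
      rw [Real.norm_of_nonneg (by positivity), div_le_one hp]
      nlinarith [sq_nonneg t]
    have e6 : ‖δ ^ 2 * t / (t ^ 2 + δ ^ 2)‖ ≤ δ := by
      rw [norm_div, Real.norm_of_nonneg hp.le, div_le_iff₀ hp, norm_mul,
        Real.norm_of_nonneg (by positivity : (0 : ℝ) ≤ δ ^ 2), Real.norm_eq_abs]
      have : t ^ 2 = |t| ^ 2 := (sq_abs t).symm
      rw [this]
      nlinarith [sq_nonneg (|t| - δ), abs_nonneg t, mul_pos hδ hδ, mul_nonneg hδ.le (abs_nonneg t),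
        mul_nonneg hδ.le (sq_nonneg (|t| - δ)), mul_nonneg hδ.le (sq_nonneg (|t|)), pow_pos hδ 3]
    calc _ ≤ 1 * δ := mul_le_mul e5 e6 (norm_nonneg _) zero_le_one
      _ = δ := one_mul _
  nlinarith [norm_nonneg (star x * (1 - h * g))]

theorem closure_star (J : TwoSidedIdeal A) {x : A} (hx : x ∈ closure (J : Set A)) :
    star x ∈ closure (J : Set A) := by
  have := map_mem_closure (t := closure (J : Set A)) continuous_star hx
    fun y hy => star_mem_closure J hy
  rwa [closure_closure] at this

theorem closure_add (J : TwoSidedIdeal A) {x y : A} (hx : x ∈ closure (J : Set A))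
    (hy : y ∈ closure (J : Set A)) : x + y ∈ closure (J : Set A) :=
  map_mem_closure₂ continuous_add hx hy fun _ ha _ hb => J.add_mem ha hb

theorem closure_mul_left (J : TwoSidedIdeal A) (x : A) {y : A} (hy : y ∈ closure (J : Set A)) :
    x * y ∈ closure (J : Set A) :=
  map_mem_closure (f := fun z => x * z) (by fun_prop) hy fun _ hb => J.mul_mem_left _ _ hb

theorem closure_mul_right (J : TwoSidedIdeal A) (x : A) {y : A} (hy : y ∈ closure (J : Set A)) :
    y * x ∈ closure (J : Set A) :=
  map_mem_closure (f := fun z => z * x) (by fun_prop) hy fun _ hb => J.mul_mem_right _ _ hb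

theorem closure_zero (J : TwoSidedIdeal A) : (0 : A) ∈ closure (J : Set A) :=
  subset_closure J.zero_mem

theorem closure_sum (J : TwoSidedIdeal A) {ι : Type*} (s : Finset ι) (f : ι → A)
    (h : ∀ i ∈ s, f i ∈ closure (J : Set A)) : ∑ i ∈ s, f i ∈ closure (J : Set A) :=
  Finset.sum_induction f (· ∈ closure (J : Set A)) (fun _ _ => closure_add J) (closure_zero J) h

theorem Lam_iterate_shift (x : Matrix ℕ ℕ A) (j m n : ℕ) :
    ((Lam α)^[j] x) (m + j) (n + j) = α^[j] (x m n) := by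
  induction j with
  | zero => rfl
  | succ j ih => rw [Function.iterate_succ_apply', ← add_assoc, ← add_assoc, Lam_succ, ih,
      Function.iterate_succ_apply']

/-- `∑_{j ≤ i} α^{i-j}(a_j^{(k)})` is the `i`-th entry on the `k`-th diagonal of
`∑_{j ≥ 0} Λ^j(a)`. -/
theorem MatAlg.diagSum_succ (a : MatAlg α) (k : ℤ) (i : ℕ) :
    a.diagSum k (i + 1) = a.diag k (i + 1) + α (a.diagSum k i) := by
  rw [diagSum, Finset.sum_range_succ, add_comm, diagSum, map_sum]
  congr 1
  · simp
  · refine Finset.sum_congr rfl fun j hj => ?_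
    rw [← Function.iterate_succ_apply' α]
    congr 2
    have := Finset.mem_range.1 hj
    omega

theorem MatAlg.diagSum_eq (a : MatAlg α) (k : ℤ) (i : ℕ) :
    a.diagSum k i = a.ev (i + (-k).toNat) (i + k.toNat) := by
  induction i with
  | zero =>
    have h0 : Lam α (lamSum α 0 a.val) (0 + (-k).toNat) (0 + k.toNat) = 0 := by
      rcases le_total 0 k with hk | hk
      · rw [Int.toNat_of_nonpos (by omega : -k ≤ 0)]; exact Lam_zero_left _ _
      · rw [Int.toNat_of_nonpos hk]; exact Lam_zero_right _ _
    rw [show a.ev = lamSum α 0 a.val from rfl, lamSum_zero, Matrix.add_apply, h0, add_zero]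
    simp [diagSum, diag]
  | succ i ih =>
    have h := congrFun₂ (lamSum_zero (α := α) a.val) (i + (-k).toNat + 1) (i + k.toNat + 1)
    rw [Matrix.add_apply, Lam_succ] at h
    rw [diagSum_succ, ih, add_right_comm i 1, add_right_comm i 1]
    refine Eq.trans ?_ h.symm
    simp only [diag, add_right_comm i 1, ev]

theorem MatAlg.exists_diag_bound (a : MatAlg α) : ∃ N : ℕ,
    (∀ k n, N ≤ n → a.diag k n = 0) ∧
    ∀ k : ℤ, (N ≤ k.natAbs) → ∀ n, a.diag k n = 0 := by
  obtain ⟨N, hN⟩ := a.exists_bound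
  exact ⟨N, fun k n hn => hN _ _ (by omega), fun k hk n => hN _ _ (by omega)⟩

theorem norm_hom_le (x : A) : ‖α x‖ ≤ ‖x‖ := NonUnitalStarAlgHom.norm_apply_le α x

theorem norm_iter_le (j : ℕ) (x : A) : ‖α^[j] x‖ ≤ ‖x‖ := by
  induction j with
  | zero => exact le_rfl
  | succ j ih => rw [Function.iterate_succ_apply']; exact (norm_hom_le _).trans ih

theorem norm_hom_le_infDist (x : A) : ‖α x‖ ≤ Metric.infDist x {y : A | α y = 0} := by
  have hne : {y : A | α y = 0}.Nonempty := ⟨0, map_zero α⟩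
  refine (Metric.le_infDist hne).2 fun {y} hy => ?_
  have hy' : α y = 0 := hy
  have := norm_hom_le (α := α) (x - y)
  rwa [map_sub, hy', sub_zero, ← dist_eq_norm] at this

theorem infDist_ker_le (x : A) : Metric.infDist x {y : A | α y = 0} ≤ ‖x‖ := by
  rw [← dist_zero_right]
  exact Metric.infDist_le_dist_of_mem (map_zero α)

theorem infDist_ideal_le (J : TwoSidedIdeal A) (x : A) :
    Metric.infDist x (J : Set A) ≤ ‖x‖ := by
  rw [← dist_zero_right]
  exact Metric.infDist_le_dist_of_mem J.zero_mem

theorem MatAlg.diagSum_tail (a : MatAlg α) {N : ℕ} (hN : ∀ k n, N ≤ n → a.diag k n = 0)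
    (k : ℤ) (n : ℕ) : a.diagSum k (N + n) = α^[n] (a.diagSum k N) := by
  induction n with
  | zero => rfl
  | succ n ih =>
    rw [← add_assoc, diagSum_succ, hN k _ (by omega), zero_add, ih, Function.iterate_succ_apply']

theorem MatAlg.diagSum_bounded (a : MatAlg α) (k : ℤ) : ∃ C : ℝ, ∀ i, ‖a.diagSum k i‖ ≤ C := by
  obtain ⟨N, hN, -⟩ := a.exists_diag_bound
  refine ⟨∑ j ∈ Finset.range (N + 1), ‖a.diagSum k j‖, fun i => ?_⟩
  have key : ∀ j ≤ N, ‖a.diagSum k j‖ ≤ ∑ j ∈ Finset.range (N + 1), ‖a.diagSum k j‖ := fun j hj =>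
    Finset.single_le_sum (f := fun j => ‖a.diagSum k j‖) (fun _ _ => norm_nonneg _)
      (Finset.mem_range.2 (by omega))
  rcases le_total i N with h | h
  · exact key i h
  · obtain ⟨n, rfl⟩ := Nat.exists_eq_add_of_le h
    rw [a.diagSum_tail hN]
    exact (norm_iter_le _ _).trans (key N le_rfl)

/-- The limits in the definition of the seminorm exist. -/
theorem MatAlg.exists_tendsto_diagDist (J : TwoSidedIdeal A) (a : MatAlg α) (k : ℤ) :
    ∃ l, Tendsto (a.diagDist J k) atTop (𝓝 l) := by
  obtain ⟨C, hC⟩ := a.diagSum_bounded k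
  obtain ⟨N, hN, -⟩ := a.exists_diag_bound
  have h1 : Monotone fun n : ℕ => (Finset.range (n + 1)).sup' Finset.nonempty_range_add_one
      fun i => Metric.infDist (a.diagSum k i) (J : Set A) := fun m n hmn =>
    Finset.sup'_mono _ (Finset.range_mono (by omega)) _
  have h2 : BddAbove (Set.range fun n : ℕ =>
      (Finset.range (n + 1)).sup' Finset.nonempty_range_add_one
        fun i => Metric.infDist (a.diagSum k i) (J : Set A)) := by
    refine ⟨C, ?_⟩
    rintro _ ⟨n, rfl⟩
    exact Finset.sup'_le _ _ fun i _ => (infDist_ideal_le J _).trans (hC i)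
  have h3 : Antitone fun n => Metric.infDist (a.diagSum k (n + N)) {x : A | α x = 0} := by
    refine antitone_nat_of_succ_le fun n => ?_
    rw [add_right_comm, diagSum_succ, hN k _ (by omega), zero_add]
    exact (infDist_ker_le _).trans (norm_hom_le_infDist _)
  have h4 : BddBelow (Set.range fun n =>
      Metric.infDist (a.diagSum k (n + N)) {x : A | α x = 0}) := by
    refine ⟨0, ?_⟩
    rintro _ ⟨n, rfl⟩
    exact Metric.infDist_nonneg
  have h5 := (tendsto_add_atTop_iff_nat
    (f := fun n => Metric.infDist (a.diagSum k n) {x : A | α x = 0}) N).1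
    (tendsto_atTop_ciInf h3 h4)
  exact ⟨_, (tendsto_atTop_ciSup h1 h2).max h5⟩

theorem MatAlg.tendsto_diagDist (J : TwoSidedIdeal A) (a : MatAlg α) (k : ℤ) :
    Tendsto (a.diagDist J k) atTop (𝓝 (limUnder atTop (a.diagDist J k))) :=
  tendsto_nhds_limUnder (a.exists_tendsto_diagDist J k)

theorem MatAlg.diagDist_nonneg (J : TwoSidedIdeal A) (a : MatAlg α) (k : ℤ) (n : ℕ) :
    0 ≤ a.diagDist J k n := le_max_of_le_right Metric.infDist_nonneg

theorem MatAlg.seminorm_eq_zero_iff_lim (J : TwoSidedIdeal A) (a : MatAlg α) :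
    a.seminorm J = 0 ↔ ∀ k, Tendsto (a.diagDist J k) atTop (𝓝 0) := by
  have hl : ∀ k, 0 ≤ limUnder atTop (a.diagDist J k) := fun k =>
    ge_of_tendsto' (a.tendsto_diagDist J k) (a.diagDist_nonneg J k)
  have hfin : (Function.support fun k : ℤ => limUnder atTop (a.diagDist J k)).Finite := by
    obtain ⟨N, -, hN⟩ := a.exists_diag_bound
    refine (Set.finite_Icc (-(N : ℤ)) N).subset fun k hk => ?_
    by_contra hc
    refine hk ?_
    have h0 : ∀ i, a.diagSum k i = 0 := fun i =>
      Finset.sum_eq_zero fun j _ => by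
        rw [hN k (by simp only [Set.mem_Icc, not_and_or, not_le] at hc; omega)]
        exact iterate_map_zero α _
    have h1 : a.diagDist J k = fun _ => 0 := by
      funext n
      simp only [diagDist, h0, Metric.infDist_zero_of_mem (show (0 : A) ∈ (J : Set A) from J.zero_mem),
        Metric.infDist_zero_of_mem (show (0 : A) ∈ {x : A | α x = 0} from map_zero α)]
      simp
    exact (h1 ▸ tendsto_const_nhds : Tendsto (a.diagDist J k) atTop (𝓝 0)).limUnder_eq
  constructor
  · intro h k
    have h1 : limUnder atTop (a.diagDist J k) = 0 := by
      refine le_antisymm ?_ (hl k)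
      rw [← h]
      exact single_le_finsum k hfin hl
    simpa [h1] using a.tendsto_diagDist J k
  · intro h
    exact finsum_eq_zero_of_forall_eq_zero fun k => (h k).limUnder_eq

/-- Algebraic description of the null elements of the seminorm. -/
theorem MatAlg.seminorm_eq_zero_iff (J : TwoSidedIdeal A) (a : MatAlg α) :
    a.seminorm J = 0 ↔ (∀ m n, a.ev m n ∈ closure (J : Set A)) ∧
      ∀ p q, Tendsto (fun i => a.ev (i + p) (i + q)) atTop (𝓝 0) := by
  have hne : (J : Set A).Nonempty := ⟨0, J.zero_mem⟩
  rw [seminorm_eq_zero_iff_lim]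
  constructor
  · intro h
    have hJ : ∀ k i, a.diagSum k i ∈ closure (J : Set A) := fun k i => by
      rw [Metric.mem_closure_iff_infDist_zero hne]
      refine le_antisymm ?_ Metric.infDist_nonneg
      refine ge_of_tendsto (h k) (eventually_atTop.2 ⟨i, fun n hn => ?_⟩)
      exact le_max_of_le_left (Finset.le_sup'
        (fun i => Metric.infDist (a.diagSum k i) (J : Set A)) (Finset.mem_range.2 (by omega)))
    have h0 : ∀ k, Tendsto (a.diagSum k) atTop (𝓝 0) := fun k => by
      obtain ⟨N, hN, -⟩ := a.exists_diag_bound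
      rw [← tendsto_add_atTop_iff_nat (N + 1), tendsto_zero_iff_norm_tendsto_zero]
      refine squeeze_zero (fun _ => norm_nonneg _) (fun n => ?_)
        ((tendsto_add_atTop_iff_nat N).2 (h k))
      rw [← add_assoc, diagSum_succ, hN k _ (by omega), zero_add]
      exact (norm_hom_le_infDist _).trans (le_max_right _ _)
    refine ⟨fun m n => ?_, fun p q => ?_⟩
    · have := hJ ((n : ℤ) - m) (min m n)
      rw [diagSum_eq] at this
      convert this using 2 <;> omega
    · have := (tendsto_add_atTop_iff_nat (min p q)).2 (h0 ((q : ℤ) - p))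
      refine this.congr fun i => ?_
      rw [diagSum_eq]
      congr 1 <;> omega
  · rintro ⟨hJ, h0⟩ k
    have h1 : ∀ i, Metric.infDist (a.diagSum k i) (J : Set A) = 0 := fun i => by
      rw [diagSum_eq]
      exact Metric.infDist_zero_of_mem_closure (hJ _ _)
    refine squeeze_zero (a.diagDist_nonneg J k) (fun n => ?_)
      (tendsto_zero_iff_norm_tendsto_zero.1 (h0 (-k).toNat k.toNat))
    rw [← diagSum_eq]
    refine max_le (Finset.sup'_le _ _ fun i _ => ?_) (infDist_ker_le _)
    rw [h1]
    exact norm_nonneg _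

theorem MatAlg.ev_neg (a : MatAlg α) : (-a).ev = -a.ev := by
  have := MatAlg.ev_smul (-1 : ℂ) a
  simpa using this

theorem MatAlg.ev_bounded (a : MatAlg α) (p q : ℕ) : ∃ C : ℝ, ∀ i, ‖a.ev (i + p) (i + q)‖ ≤ C := by
  obtain ⟨C, hC⟩ := a.diagSum_bounded ((q : ℤ) - p)
  refine ⟨C, fun i => ?_⟩
  have := hC (i + min p q)
  rw [diagSum_eq] at this
  convert this using 3 <;> omega

theorem MatAlg.ev_mul_shift (a b : MatAlg α) : ∃ N : ℕ, ∀ p q i,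
    (a * b).ev (i + N + p) (i + N + q) =
      ∑ d ∈ Finset.range (2 * N), a.ev (i + (N + p)) (i + (p + d)) *
        b.ev (i + (p + d)) (i + (N + q)) := by
  obtain ⟨N, hN⟩ := a.exists_bound
  refine ⟨N, fun p q i => ?_⟩
  rw [ev_mul, infMul, finsum_eq_sum_of_support_subset (s := Finset.Ico (i + p) (i + p + 2 * N))]
  · rw [Finset.sum_Ico_eq_sum_range, show i + p + 2 * N - (i + p) = 2 * N by omega]
    refine Finset.sum_congr rfl fun d _ => ?_
    simp only [add_assoc]
  · intro k hk
    simp only [Finset.coe_Ico, Set.mem_Ico]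
    by_contra hc
    refine hk ?_
    have : a.ev (i + N + p) k = 0 := lamSum_band hN _ _ (by omega)
    simp [this]

theorem tendsto_mul_of_bounded {f g : ℕ → A} {C : ℝ} (hf : Tendsto f atTop (𝓝 0))
    (hg : ∀ i, ‖g i‖ ≤ C) : Tendsto (fun i => f i * g i) atTop (𝓝 0) := by
  rw [tendsto_zero_iff_norm_tendsto_zero] at *
  refine squeeze_zero (fun _ => norm_nonneg _) (fun i => ?_) (by simpa using hf.mul_const C)
  exact (norm_mul_le _ _).trans (mul_le_mul_of_nonneg_left (hg i) (norm_nonneg _))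

theorem tendsto_bounded_mul {f g : ℕ → A} {C : ℝ} (hf : Tendsto f atTop (𝓝 0))
    (hg : ∀ i, ‖g i‖ ≤ C) : Tendsto (fun i => g i * f i) atTop (𝓝 0) := by
  rw [tendsto_zero_iff_norm_tendsto_zero] at *
  refine squeeze_zero (fun _ => norm_nonneg _) (fun i => ?_) (by simpa using hf.const_mul C)
  exact (norm_mul_le _ _).trans (mul_le_mul_of_nonneg_right (hg i) (norm_nonneg _))

variable (α) in
/-- The two-sided ideal `{a : |||a|||_J = 0}` of the matrix algebra. -/
noncomputable def nullIdeal (J : TwoSidedIdeal A) : TwoSidedIdeal (MatAlg α) :=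
  TwoSidedIdeal.mk' {a : MatAlg α | a.seminorm J = 0}
    (by
      simp only [Set.mem_ofPred_eq, MatAlg.seminorm_eq_zero_iff, MatAlg.ev_zero]
      exact ⟨fun _ _ => closure_zero J, fun _ _ => tendsto_const_nhds⟩)
    (by
      intro a b ha hb
      simp only [Set.mem_ofPred_eq, MatAlg.seminorm_eq_zero_iff, MatAlg.ev_add] at *
      exact ⟨fun m n => closure_add J (ha.1 m n) (hb.1 m n), fun p q => by
        simpa using (ha.2 p q).add (hb.2 p q)⟩)
    (by
      intro a ha
      simp only [Set.mem_ofPred_eq, MatAlg.seminorm_eq_zero_iff, MatAlg.ev_neg] at *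
      exact ⟨fun m n => by simpa using closure_mul_left J (-1) (ha.1 m n), fun p q => by
        simpa using (ha.2 p q).neg⟩)
    (by
      intro a b hb
      simp only [Set.mem_ofPred_eq, MatAlg.seminorm_eq_zero_iff] at *
      refine ⟨fun m n => ?_, fun p q => ?_⟩
      · obtain ⟨K, hK⟩ := a.ev_rowFin m
        rw [MatAlg.ev_mul, infMul_eq_sum _ hK]
        exact closure_sum J _ _ fun k _ => closure_mul_left J _ (hb.1 _ _)
      · obtain ⟨N, hN⟩ := a.ev_mul_shift b
        rw [← tendsto_add_atTop_iff_nat N]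
        simp only [hN]
        rw [← Finset.sum_const_zero (s := Finset.range (2 * N))]
        refine tendsto_finsetSum _ fun d _ => ?_
        obtain ⟨C, hC⟩ := a.ev_bounded (N + p) (p + d)
        exact tendsto_bounded_mul (hb.2 _ _) hC)
    (by
      intro a b ha
      simp only [Set.mem_ofPred_eq, MatAlg.seminorm_eq_zero_iff] at *
      refine ⟨fun m n => ?_, fun p q => ?_⟩
      · obtain ⟨K, hK⟩ := a.ev_rowFin m
        rw [MatAlg.ev_mul, infMul_eq_sum _ hK]
        exact closure_sum J _ _ fun k _ => closure_mul_right J _ (ha.1 _ _)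
      · obtain ⟨N, hN⟩ := a.ev_mul_shift b
        rw [← tendsto_add_atTop_iff_nat N]
        simp only [hN]
        rw [← Finset.sum_const_zero (s := Finset.range (2 * N))]
        refine tendsto_finsetSum _ fun d _ => ?_
        obtain ⟨C, hC⟩ := b.ev_bounded (p + d) (N + q)
        exact tendsto_mul_of_bounded (ha.2 _ _) hC)

theorem mem_nullIdeal {J : TwoSidedIdeal A} {a : MatAlg α} :
    a ∈ nullIdeal α J ↔ a.seminorm J = 0 := TwoSidedIdeal.mem_mk' _ _ _ _ _ _ _

theorem star_mem_nullIdeal {J : TwoSidedIdeal A} {a : MatAlg α} (ha : a ∈ nullIdeal α J) :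
    star a ∈ nullIdeal α J := by
  rw [mem_nullIdeal, MatAlg.seminorm_eq_zero_iff] at *
  rw [MatAlg.ev_star]
  refine ⟨fun m n => closure_star J (ha.1 n m), fun p q => ?_⟩
  simpa using (ha.2 q p).star

variable (α) in
/-- The quotient `*`-algebra of the matrix algebra by the null ideal of the seminorm. -/
def MatQuot (J : TwoSidedIdeal A) : Type u := (nullIdeal α J).ringCon.Quotient

variable {J : TwoSidedIdeal A}

noncomputable instance : Ring (MatQuot α J) :=
  inferInstanceAs (Ring (nullIdeal α J).ringCon.Quotient)

noncomputable instance : Algebra ℂ (MatQuot α J) :=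
  inferInstanceAs (Algebra ℂ (nullIdeal α J).ringCon.Quotient)

/-- The quotient map. -/
noncomputable def MatQuot.mk (J : TwoSidedIdeal A) (a : MatAlg α) : MatQuot α J :=
  (nullIdeal α J).ringCon.toQuotient a

theorem MatQuot.mk_eq_mk {a b : MatAlg α} :
    mk J a = mk J b ↔ (a - b).seminorm J = 0 := by
  rw [← mem_nullIdeal, ← TwoSidedIdeal.rel_iff]
  exact (nullIdeal α J).ringCon.eq

theorem MatQuot.mk_surjective : Function.Surjective (mk (α := α) J) := Quotient.mk''_surjective

theorem MatQuot.mk_add (a b : MatAlg α) : mk J (a + b) = mk J a + mk J b := rfl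
theorem MatQuot.mk_mul (a b : MatAlg α) : mk J (a * b) = mk J a * mk J b := rfl
theorem MatQuot.mk_one : mk J (1 : MatAlg α) = 1 := rfl
theorem MatQuot.mk_smul (c : ℂ) (a : MatAlg α) : mk J (c • a) = c • mk J a := rfl

noncomputable instance : Star (MatQuot α J) :=
  ⟨fun x => Quotient.liftOn' x (fun a => MatQuot.mk J (star a)) fun a b h => by
    rw [MatQuot.mk_eq_mk, ← star_sub, ← mem_nullIdeal]
    exact star_mem_nullIdeal ((TwoSidedIdeal.rel_iff _ _ _).1 h)⟩

theorem MatQuot.mk_star (a : MatAlg α) : mk J (star a) = star (mk J a) := rfl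

noncomputable instance : StarRing (MatQuot α J) where
  star_involutive x := by
    obtain ⟨a, rfl⟩ := MatQuot.mk_surjective x
    rw [← MatQuot.mk_star, ← MatQuot.mk_star, star_star]
  star_mul x y := by
    obtain ⟨a, rfl⟩ := MatQuot.mk_surjective x
    obtain ⟨b, rfl⟩ := MatQuot.mk_surjective y
    simp only [← MatQuot.mk_star, ← MatQuot.mk_mul, star_mul]
  star_add x y := by
    obtain ⟨a, rfl⟩ := MatQuot.mk_surjective x
    obtain ⟨b, rfl⟩ := MatQuot.mk_surjective y
    simp only [← MatQuot.mk_star, ← MatQuot.mk_add, star_add]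

noncomputable instance : StarModule ℂ (MatQuot α J) where
  star_smul c x := by
    obtain ⟨a, rfl⟩ := MatQuot.mk_surjective x
    simp only [← MatQuot.mk_star, ← MatQuot.mk_smul, star_smul]

end Seminorm

section CrossedProducts

variable {A : Type u} [CStarAlgebra A]

/-- `(π, U)` is a `J`-covariant representation of `(A, α)` in the unital C⋆-algebra `D`: the
unital `*`-homomorphism `π : A → D` and `U ∈ D` satisfy `U π(a) U* = π(α(a))` for all `a`, and
`J = {a | U* U π(a) = π(a)}`. -/
structure IsCovariantRep (α : A →⋆ₙₐ[ℂ] A) (J : TwoSidedIdeal A) {D : Type u} [CStarAlgebra D]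
    (π : A →⋆ₐ[ℂ] D) (U : D) : Prop where
  conj : ∀ a, U * π a * star U = π (α a)
  ideal : ∀ a, a ∈ J ↔ star U * U * π a = π a

/-- `(B, i, v)` is the universal C⋆-algebra generated by (the image of) `A` and a partial
isometry `v` subject to `v a v* = α(a)` and `J = {a | v* v a = a}`. -/
structure IsUniversalCrossedProduct (α : A →⋆ₙₐ[ℂ] A) (J : TwoSidedIdeal A)
    {B : Type u} [CStarAlgebra B] (i : A →⋆ₐ[ℂ] B) (v : B) : Prop where
  partialIsometry : v * star v * v = v
  covariant : IsCovariantRep α J i v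
  generates : (StarAlgebra.adjoin ℂ (Set.range i ∪ {v})).topologicalClosure = ⊤
  lift : ∀ (D : Type u) [CStarAlgebra D] (π : A →⋆ₐ[ℂ] D) (U : D), IsCovariantRep α J π U →
    ∃ φ : B →⋆ₐ[ℂ] D, (∀ a, φ (i a) = π a) ∧ φ v = U

/-- `(C, ι)` is the enveloping C⋆-algebra of the unital `*`-algebra `S`: the image of `S` is
dense in `C` and every `*`-representation of `S` in a C⋆-algebra extends to `C`. -/
structure IsEnvelopingCStarAlgebra {S : Type u} [Ring S] [StarRing S] [Algebra ℂ S]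
    {C : Type u} [CStarAlgebra C] (ι : S →⋆ₐ[ℂ] C) : Prop where
  denseRange : DenseRange ι
  lift : ∀ (D : Type u) [CStarAlgebra D] (ρ : S →⋆ₐ[ℂ] D), ∃ φ : C →⋆ₐ[ℂ] D, ∀ s, φ (ι s) = ρ s

end CrossedProducts

end EndoCrossed

/-! In `MatAlg α` every element is a finite sum of words `u*^i a u^j` with `a` in `A`, where `u a =
α(a) u` and `u u* = α(1)`. In any C⋆-algebra the relation `U π(a) U* = π(α(a))` already forces `U
π(a) = π(α(a)) U`, by the C⋆-identity, so words in `π`, `U` multiply by the same rule. Hence `a ↦ ∑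
U*^m π(a_{m,n}) U^n` is a `*`-homomorphism on `MatAlg α`. The proposition follows once the null
ideal of `|||·|||_J` is shown to encode exactly the remaining condition `J = {a | U*U π(a) = π(a)}`.

One direction: a covariant representation kills the null ideal. For `x` in `J` one has `π(x) = U*
π(α(x)) U`, so for a null element `a`, with `E = ∑ Λ^j(a)` and `a = E - Λ(E)`, the sum telescopes to
the boundary of a large square. Only a bounded number of boundary terms is nonzero, and they tend to
zero (`sumWord_eq_of_mem`, `sumWord_eq_zero`).

Other direction: a representation of the quotient automatically satisfies the conjugation relation
and `U*U π(a) = π(a)` for `a` in `J`. What must be excluded is that the ideal grows or that `A` is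
not embedded. Let the matrices `E` act by right multiplication on rows with the `A`-valued inner
product `∑ x_k y_k*`. The operator norm is a C⋆-seminorm dominating each diagonal entry of `E`.
After dividing by the closure of the null ideal, an element that dies still has all diagonal entries
in `J`, tending to zero (`exists_toeplitz_rep`). Applied to `a - u*u a`, whose only entry is `a`,
this gives `a ∈ J`. Applied to `a`, it gives `α^m(a) ∈ J` and `α^m(a) → 0`; since `α` is isometric
on `J`, `a = 0`.

Words are contractive in every representation, so an enveloping C⋆-algebra exists. It is a universal
crossed product, and comparing universal properties yields the unique isomorphism. -/

namespace EndoCrossed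

/-! ### C⋆-completions of `*`-algebras with a C⋆-seminorm -/

section CStarGeneral

open scoped CStarAlgebra

section Completion

open UniformSpace

variable {S : Type u} [SeminormedRing S] [StarRing S] [NormedStarGroup S]

/-- The involution of a normed `*`-algebra extends to the completion. -/
noncomputable abbrev completionStarRing : StarRing (Completion S) :=
  have hc : Continuous (Completion.map (star : S → S)) := Completion.continuous_map
  have coe_star : ∀ x : S, Completion.map star (x : Completion S) = (star x : S) := fun x =>
    Completion.map_coe (star_isometry (E := S)).uniformContinuous x
  { star := Completion.map star
    star_involutive := fun x => Completion.induction_on x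
      (isClosed_eq (hc.comp hc) continuous_id) fun x => by rw [coe_star, coe_star, star_star]
    star_mul := fun x y => Completion.induction_on₂ x y
      (isClosed_eq (hc.comp continuous_mul)
        ((hc.comp continuous_snd).mul (hc.comp continuous_fst))) fun x y => by
          rw [← Completion.coe_mul, coe_star, coe_star, coe_star, star_mul, Completion.coe_mul]
    star_add := fun x y => Completion.induction_on₂ x y
      (isClosed_eq (hc.comp continuous_add)
        ((hc.comp continuous_fst).add (hc.comp continuous_snd))) fun x y => by
          rw [← Completion.coe_add, coe_star, coe_star, coe_star, star_add, Completion.coe_add] }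

attribute [local instance] completionStarRing

theorem completion_coe_star (x : S) : star (x : Completion S) = (star x : S) :=
  Completion.map_coe (star_isometry (E := S)).uniformContinuous x

theorem completion_continuous_star : Continuous (star : Completion S → Completion S) :=
  Completion.continuous_map

/-- The completion of a `*`-algebra with respect to a C⋆-seminorm is a C⋆-algebra. -/
noncomputable abbrev cstarCompletion [NormedAlgebra ℂ S] [StarModule ℂ S]
    (h : ∀ x : S, ‖x‖ * ‖x‖ ≤ ‖star x * x‖) :
    CStarAlgebra (Completion S) where
  __ := (inferInstance : NormedRing (Completion S))
  __ := (inferInstance : StarRing (Completion S))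
  __ := (inferInstance : Algebra ℂ (Completion S))
  __ := (inferInstance : CompleteSpace (Completion S))
  norm_smul_le := fun c x => norm_smul_le c x
  norm_mul_self_le := fun x => Completion.induction_on x
    (isClosed_le (continuous_norm.mul continuous_norm)
      ((completion_continuous_star.mul continuous_id).norm)) fun x => by
      rw [completion_coe_star, ← Completion.coe_mul, Completion.norm_coe, Completion.norm_coe]
      exact h x
  star_smul := fun c x => Completion.induction_on x
    (isClosed_eq (completion_continuous_star.comp (continuous_const_smul c))
      ((continuous_const_smul (star c)).comp completion_continuous_star)) fun x => by
      rw [← Completion.coe_smul, completion_coe_star, completion_coe_star, star_smul,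
        Completion.coe_smul]

end Completion

/-- A `*`-algebra with a C⋆-seminorm maps densely and isometrically into a C⋆-algebra. -/
theorem exists_cstarCompletion {S : Type u} [Ring S] [StarRing S] [Algebra ℂ S] [StarModule ℂ S]
    (p : Seminorm ℂ S) (hmul : ∀ x y, p (x * y) ≤ p x * p y)
    (hstar : ∀ x, p x * p x ≤ p (star x * x)) :
    ∃ (C : Type u) (_ : CStarAlgebra C) (ι : S →⋆ₐ[ℂ] C), DenseRange ι ∧ ∀ x, ‖ι x‖ = p x := by
  -- Cancelling `p x` in `p x * p x ≤ p (star x * x) ≤ p (star x) * p x` makes the involution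
  -- isometric, so it extends to the completion.
  have hle : ∀ x, p x ≤ p (star x) := fun x => by
    rcases (apply_nonneg p x).eq_or_lt with h | h
    · rw [← h]; exact apply_nonneg p _
    · exact le_of_mul_le_mul_right ((hstar x).trans (hmul _ _)) h
  let _ : SeminormedRing S :=
    { (inferInstance : Ring S), p.toAddGroupSeminorm.toSeminormedAddGroup with
      norm_mul_le := hmul }
  let _ : NormedStarGroup S := ⟨fun x => (hle (star x)).trans_eq (by rw [star_star]; rfl)⟩
  let _ : NormedAlgebra ℂ S :=
    { (inferInstance : Algebra ℂ S) with
      norm_smul_le := fun c x => (map_smul_eq_mul p c x).le }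
  let inst := cstarCompletion (S := S) hstar
  refine ⟨UniformSpace.Completion S, inst,
    { (UniformSpace.Completion.coeRingHom : S →+* UniformSpace.Completion S) with
      commutes' := fun c => rfl
      map_star' := fun x =>
        (UniformSpace.Completion.map_coe (star_isometry (E := S)).uniformContinuous x).symm },
    UniformSpace.Completion.denseRange_coe, fun x => UniformSpace.Completion.norm_coe x⟩

/-- A `*`-homomorphism dominated by one with dense range factors through it. -/
theorem exists_lift_of_norm_le {S C D : Type*} [Ring S] [StarRing S] [Algebra ℂ S]
    [CStarAlgebra C] [CStarAlgebra D] (ι : S →⋆ₐ[ℂ] C) (hι : DenseRange ι) (ρ : S →⋆ₐ[ℂ] D)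
    (h : ∀ x, ‖ρ x‖ ≤ ‖ι x‖) : ∃ φ : C →⋆ₐ[ℂ] D, ∀ x, φ (ι x) = ρ x := by
  set f : C →L[ℂ] D := LinearMap.extendOfNorm ρ.toAlgHom.toLinearMap ι.toAlgHom.toLinearMap
  have hf : ∀ x, f (ι x) = ρ x := fun x =>
    LinearMap.extendOfNorm_eq (f := ρ.toAlgHom.toLinearMap) (e := ι.toAlgHom.toLinearMap) hι
      ⟨1, fun x => by simpa using h x⟩ x
  refine ⟨{ f.toLinearMap with
    map_one' := by simpa using hf 1
    map_mul' := fun x y => ?_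
    map_zero' := map_zero f
    commutes' := fun c => by
      have := hf (algebraMap ℂ S c)
      rwa [AlgHomClass.commutes ι, AlgHomClass.commutes ρ] at this
    map_star' := fun x => ?_ }, hf⟩
  · refine hι.induction_on₂ (p := fun x y => f (x * y) = f x * f y)
      (isClosed_eq (by fun_prop) (by fun_prop)) (fun x y => ?_) x y
    rw [← map_mul, hf, hf, hf, map_mul]
  · refine hι.induction_on (p := fun x => f (star x) = star (f x)) x
      (isClosed_eq (by fun_prop) (by fun_prop)) (fun x => ?_)
    rw [← map_star, hf, hf, map_star]

/-- `*`-homomorphisms agreeing on a dense range agree. -/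
theorem eq_of_denseRange {S C D : Type*} [CStarAlgebra C] [CStarAlgebra D] {ι : S → C}
    (hι : DenseRange ι) {φ ψ : C →⋆ₐ[ℂ] D} (h : ∀ x, φ (ι x) = ψ (ι x)) : φ = ψ :=
  DFunLike.coe_injective (hι.equalizer
    (map_continuous φ) (map_continuous ψ) (funext h))

end CStarGeneral

/-! ### Quotients of C⋆-algebras by two-sided ideals -/

section Quotient

variable {T : Type u} [CStarAlgebra T]

/-- Approximate units relative to one element of an ideal. -/
theorem exists_approx_unit (K : TwoSidedIdeal T) {k : T} (hk : k ∈ K) {ε : ℝ} (hε : 0 < ε) :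
    ∃ w : T, IsSelfAdjoint w ∧ ‖w‖ ≤ 1 ∧ 1 - w ∈ K ∧ ‖w * k‖ ≤ ε := by
  -- The functional calculus below bounds `‖w * k‖ ^ 2` by `δ`.
  obtain ⟨δ, hδ, hδε⟩ : ∃ δ : ℝ, 0 < δ ∧ δ < ε ^ 2 := exists_between (by positivity)
  set h : T := k * star k with hh
  have hsa : IsSelfAdjoint h := IsSelfAdjoint.mul_star_self k
  have h1 : h = cfc (fun t : ℝ => t) h := (cfc_id' ℝ h).symm
  have hpos : ∀ t : ℝ, 0 < t ^ 2 + δ ^ 2 := fun t => by positivity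
  have hc : Continuous fun t : ℝ => t / (t ^ 2 + δ ^ 2) :=
    continuous_id.div (by fun_prop) fun t => (hpos t).ne'
  have hc1 : Continuous fun t : ℝ => δ ^ 2 / (t ^ 2 + δ ^ 2) :=
    continuous_const.div (by fun_prop) fun t => (hpos t).ne'
  -- This function is chosen because `1 - w` is then an honest multiple of `h = k k*`, so it lies in
  -- `K` itself even when `K` is not closed.
  set w : T := cfc (fun t : ℝ => δ ^ 2 / (t ^ 2 + δ ^ 2)) h with hw
  have hwsa : IsSelfAdjoint w := cfc_predicate _ _
  have hbound : ∀ t : ℝ, ‖δ ^ 2 / (t ^ 2 + δ ^ 2)‖ ≤ 1 := fun t => by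
    rw [Real.norm_of_nonneg (by have := hpos t; positivity), div_le_one (hpos t)]
    nlinarith [sq_nonneg t]
  refine ⟨w, hwsa, norm_cfc_le zero_le_one fun t _ => hbound t, ?_, ?_⟩
  · have e : 1 - w = h * cfc (fun t : ℝ => t / (t ^ 2 + δ ^ 2)) h := by
      have e0 : h * cfc (fun t : ℝ => t / (t ^ 2 + δ ^ 2)) h =
          cfc (fun t : ℝ => t * (t / (t ^ 2 + δ ^ 2))) h := by
        rw [cfc_mul (fun t : ℝ => t) (fun t : ℝ => t / (t ^ 2 + δ ^ 2)) h (by fun_prop)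
          hc.continuousOn, ← h1]
      rw [e0, hw, ← cfc_one ℝ h, ← cfc_sub (1 : ℝ → ℝ) _ h (by fun_prop)
        hc1.continuousOn]
      refine cfc_congr fun t _ => ?_
      have := (hpos t).ne'
      simp only [Pi.one_apply]
      field_simp
      ring
    rw [e]
    exact K.mul_mem_right _ _ (K.mul_mem_right _ _ hk)
  · have e2 : w * k * star (w * k)
        = cfc (fun t : ℝ => δ ^ 2 / (t ^ 2 + δ ^ 2) * t * (δ ^ 2 / (t ^ 2 + δ ^ 2))) h := by
      rw [cfc_mul (fun t : ℝ => δ ^ 2 / (t ^ 2 + δ ^ 2) * t) _ h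
        (hc1.mul continuous_id).continuousOn hc1.continuousOn,
        cfc_mul _ (fun t : ℝ => t) h hc1.continuousOn (by fun_prop), ← h1, ← hw, star_mul,
        hwsa.star_eq, hh]
      simp only [mul_assoc]
    have e3 : ‖w * k‖ * ‖w * k‖ ≤ δ := by
      rw [← CStarRing.norm_self_mul_star, e2]
      refine norm_cfc_le hδ.le fun t _ => ?_
      have hp := hpos t
      have e4 : δ ^ 2 / (t ^ 2 + δ ^ 2) * t * (δ ^ 2 / (t ^ 2 + δ ^ 2))
          = (δ ^ 2 / (t ^ 2 + δ ^ 2)) * (δ * (δ * t / (t ^ 2 + δ ^ 2))) := by ring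
      have e6 : ‖δ * (δ * t / (t ^ 2 + δ ^ 2))‖ ≤ δ := by
        rw [norm_mul, Real.norm_of_nonneg hδ.le, norm_div, Real.norm_of_nonneg hp.le, norm_mul,
          Real.norm_of_nonneg hδ.le, Real.norm_eq_abs]
        refine mul_le_of_le_one_right hδ.le ((div_le_one hp).2 ?_)
        nlinarith [sq_nonneg (|t| - δ), sq_abs t, abs_nonneg t, mul_nonneg hδ.le (abs_nonneg t)]
      rw [e4, norm_mul]
      calc _ ≤ 1 * δ := mul_le_mul (hbound t) e6 (norm_nonneg _) zero_le_one
        _ = δ := one_mul _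
    nlinarith [norm_nonneg (w * k)]

theorem infDist_ideal_lt_iff (K : TwoSidedIdeal T) {x : T} {r : ℝ} :
    Metric.infDist x (K : Set T) < r ↔ ∃ k ∈ K, ‖x - k‖ < r := by
  simp only [Metric.infDist_lt_iff ⟨0, K.zero_mem⟩, dist_eq_norm, SetLike.mem_coe]

theorem infDist_ideal_mul_le (K : TwoSidedIdeal T) (x y : T) :
    Metric.infDist (x * y) (K : Set T) ≤
      Metric.infDist x (K : Set T) * Metric.infDist y (K : Set T) := by
  have key : ∀ ε > 0, Metric.infDist (x * y) (K : Set T) ≤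
      (Metric.infDist x (K : Set T) + ε) * (Metric.infDist y (K : Set T) + ε) := fun ε hε => by
    obtain ⟨k, hk, hkx⟩ := (infDist_ideal_lt_iff K).1 (lt_add_of_pos_right
      (Metric.infDist x (K : Set T)) hε)
    obtain ⟨l, hl, hly⟩ := (infDist_ideal_lt_iff K).1 (lt_add_of_pos_right
      (Metric.infDist y (K : Set T)) hε)
    have hm : k * y + (x - k) * l ∈ K :=
      K.add_mem (K.mul_mem_right _ _ hk) (K.mul_mem_left _ _ hl)
    calc Metric.infDist (x * y) (K : Set T) ≤ dist (x * y) (k * y + (x - k) * l) :=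
          Metric.infDist_le_dist_of_mem hm
      _ = ‖(x - k) * (y - l)‖ := by rw [dist_eq_norm]; congr 1; noncomm_ring
      _ ≤ ‖x - k‖ * ‖y - l‖ := norm_mul_le _ _
      _ ≤ _ := mul_le_mul hkx.le hly.le (norm_nonneg _) (add_nonneg Metric.infDist_nonneg hε.le)
  have hc : Tendsto (fun ε : ℝ => (Metric.infDist x (K : Set T) + ε) *
      (Metric.infDist y (K : Set T) + ε)) (𝓝[>] 0)
      (𝓝 ((Metric.infDist x (K : Set T) + 0) * (Metric.infDist y (K : Set T) + 0))) :=
    (Continuous.tendsto (by fun_prop) 0).mono_left nhdsWithin_le_nhds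
  simpa using ge_of_tendsto hc (eventually_nhdsWithin_of_forall key)

/-- This is the C⋆-inequality for the quotient norm. Choose `k` in `K` nearly optimal for `star x *
x` and `w` from `exists_approx_unit`. Since `x (1 - w)` is in `K`, the distance of `x` is at most
`‖x w‖`, and `‖x w‖² = ‖w (x*x - k) w + w k w‖` is at most `‖x*x - k‖` plus a small term. -/
theorem infDist_ideal_mul_self_le (K : TwoSidedIdeal T) (x : T) :
    Metric.infDist x (K : Set T) * Metric.infDist x (K : Set T) ≤
      Metric.infDist (star x * x) (K : Set T) := by
  refine le_of_forall_pos_le_add fun ε hε => ?_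
  obtain ⟨k, hk, hkx⟩ := (infDist_ideal_lt_iff K).1 (lt_add_of_pos_right
      (Metric.infDist (star x * x) (K : Set T)) (half_pos hε))
  obtain ⟨w, hw, hw1, hwK, hwk⟩ := exists_approx_unit K hk (half_pos hε)
  have h1 : Metric.infDist x (K : Set T) ≤ ‖x * w‖ := by
    have := Metric.infDist_le_dist_of_mem (x := x) (K.mul_mem_left x _ hwK)
    rwa [dist_eq_norm, mul_sub, mul_one, sub_sub_cancel] at this
  calc _ ≤ ‖x * w‖ * ‖x * w‖ := mul_self_le_mul_self Metric.infDist_nonneg h1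
    _ = ‖w * (star x * x - k) * w + w * k * w‖ := by
        rw [← CStarRing.norm_star_mul_self, star_mul, hw.star_eq]; congr 1; noncomm_ring
    _ ≤ ‖w‖ * ‖star x * x - k‖ * ‖w‖ + ‖w * k‖ * ‖w‖ := (norm_add_le _ _).trans
        (add_le_add ((norm_mul_le _ _).trans (by gcongr; exact norm_mul_le _ _))
          (norm_mul_le _ _))
    _ ≤ 1 * ‖star x * x - k‖ * 1 + ‖w * k‖ * 1 := by gcongr
    _ ≤ _ := by linarith

/-- The quotient of a C⋆-algebra by the closure of a two-sided ideal. -/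
theorem exists_cstarQuotient (K : TwoSidedIdeal T) :
    ∃ (D : Type u) (_ : CStarAlgebra D) (ψ : T →⋆ₐ[ℂ] D),
      ∀ x, ψ x = 0 ↔ x ∈ closure (K : Set T) := by
  obtain ⟨D, hD, ψ, -, hψ⟩ := exists_cstarCompletion
    (Seminorm.ofSMulLE (𝕜 := ℂ) (fun x : T => Metric.infDist x (K : Set T))
      (Metric.infDist_zero_of_mem K.zero_mem)
      (fun x y => by
        refine le_of_forall_pos_le_add fun ε hε => ?_
        obtain ⟨k, hk, hkx⟩ := (infDist_ideal_lt_iff K).1 (lt_add_of_pos_right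
          (Metric.infDist x (K : Set T)) (half_pos hε))
        obtain ⟨l, hl, hly⟩ := (infDist_ideal_lt_iff K).1 (lt_add_of_pos_right
          (Metric.infDist y (K : Set T)) (half_pos hε))
        have h1 := Metric.infDist_le_dist_of_mem (x := x + y) (K.add_mem hk hl)
        have h2 := norm_add_le (x - k) (y - l)
        rw [dist_eq_norm, add_sub_add_comm] at h1
        linarith)
      (fun c x => by
        refine (eq_or_ne c 0).elim (fun hc => ?_) fun hc => ?_
        · rw [hc, zero_smul, norm_zero, zero_mul, Metric.infDist_zero_of_mem K.zero_mem]
        · rw [← div_le_iff₀' (norm_pos_iff.2 hc)]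
          refine (Metric.le_infDist ⟨0, K.zero_mem⟩).2 fun {k} hk => ?_
          rw [div_le_iff₀' (norm_pos_iff.2 hc), dist_eq_norm, ← norm_smul, smul_sub]
          have : c • k ∈ K := by
            rw [← one_mul k, ← smul_mul_assoc]
            exact K.mul_mem_left _ _ hk
          have h1 := Metric.infDist_le_dist_of_mem (x := c • x) this
          rwa [dist_eq_norm] at h1))
    (infDist_ideal_mul_le K) (infDist_ideal_mul_self_le K)
  refine ⟨D, hD, ψ, fun x => ?_⟩
  rw [← norm_eq_zero, hψ, Metric.mem_closure_iff_infDist_zero ⟨0, K.zero_mem⟩]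
  rfl

end Quotient

/-! ### The matrix algebra as the span of the words `u*^i a u^j` -/

section Generators

variable {A : Type u} [CStarAlgebra A] {α : A →⋆ₙₐ[ℂ] A}

theorem iter_one_mul_iter (i d : ℕ) : α^[i] (1 : A) * α^[i + d] 1 = α^[i + d] 1 := by
  rw [Function.iterate_add_apply, ← iter_mul, one_mul]

namespace MatAlg

variable (α) in
/-- The matrix with `α^i(1) x α^j(1)` at `(i, j)` and zeros elsewhere. -/
noncomputable def unit (i j : ℕ) (x : A) : MatAlg α :=
  ⟨single i j (α^[i] 1 * x * α^[j] 1), single_mem ⟨x, rfl⟩⟩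

theorem val_unit (i j : ℕ) (x : A) : (unit α i j x).val = single i j (α^[i] 1 * x * α^[j] 1) := rfl

theorem unit_zero_zero (x : A) : unit α 0 0 x = of α x := ext <| by
  rw [val_unit]; simp [of, val]

theorem unit_zero_one : unit α 0 1 1 = u α := ext <| by
  rw [val_unit]; simp [u, val]

theorem star_unit (i j : ℕ) (x : A) : star (unit α i j x) = unit α j i (star x) := ext <| by
  rw [val_star, val_unit, val_unit]
  ext m n
  simp only [Matrix.conjTranspose_apply, single]
  split_ifs with h1 h2 h2
  · simp [iter_one_star, mul_assoc]
  · exact absurd h1.symm h2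
  · exact absurd h2.symm h1
  · exact star_zero A

/-- The displayed matrix solves `x = c + Λ(x)` with `c` the one-entry matrix, and that equation has
only one solution. The solution lives on the diagonal through `(i, j)`, from that position on. -/
theorem ev_unit (i j : ℕ) (x : A) (m n : ℕ) : (unit α i j x).ev m n =
    if m + j = n + i ∧ i ≤ m then α^[m] 1 * α^[m - i] x * α^[n] 1 else 0 := by
  obtain ⟨F, hF⟩ : ∃ F : Matrix ℕ ℕ A, ∀ m n, F m n =
      if m + j = n + i ∧ i ≤ m then α^[m] 1 * α^[m - i] x * α^[n] 1 else 0 := ⟨_, fun _ _ => rfl⟩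
  have : (unit α i j x).ev = F := by
    refine lamSum_eq_of (α := α) ?_
    rw [val_unit]
    refine Lam_ext (fun n => ?_) (fun m => ?_) (fun m n => ?_)
    · rw [Matrix.add_apply, Lam_zero_left, add_zero, single, hF]
      by_cases h : 0 = i ∧ n = j
      · obtain ⟨rfl, rfl⟩ := h; simp
      · rw [if_neg h, if_neg (by omega)]
    · rw [Matrix.add_apply, Lam_zero_right, add_zero, single, hF]
      by_cases h : m = i ∧ 0 = j
      · obtain ⟨rfl, rfl⟩ := h; simp
      · rw [if_neg h, if_neg (by omega)]
    · rw [Matrix.add_apply, Lam_succ, single, hF, hF]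
      by_cases h : m + 1 = i ∧ n + 1 = j
      · obtain ⟨rfl, rfl⟩ := h
        rw [if_pos (by omega), if_pos ⟨rfl, rfl⟩, if_neg (by omega), map_zero, add_zero]
        simp
      · rw [if_neg h, zero_add]
        by_cases h' : m + 1 + j = n + 1 + i ∧ i ≤ m + 1
        · rw [if_pos h', if_pos (by omega), map_mul, map_mul, ← Function.iterate_succ_apply' α,
            ← Function.iterate_succ_apply' α, ← Function.iterate_succ_apply' α,
            show (m - i).succ = m + 1 - i by omega]
        · rw [if_neg h', if_neg (by omega), map_zero]
  rw [this, hF]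

theorem ev_of (a : A) (m n : ℕ) : (of α a).ev m n = if m = n then α^[m] a else 0 := by
  rw [← unit_zero_zero, ev_unit]
  by_cases h : m = n
  · subst h; simp [← iter_mul]
  · simp [h]

theorem ev_u (m n : ℕ) : (u α).ev m n = if n = m + 1 then α^[n] 1 else 0 := by
  rw [← unit_zero_one, ev_unit]
  by_cases h : n = m + 1
  · subst h; simp [← iter_mul]
  · rw [if_neg h, if_neg (by omega)]

theorem ev_mul_of (x : MatAlg α) (a : A) (m n : ℕ) :
    (x * of α a).ev m n = x.ev m n * α^[n] a := by
  rw [ev_mul, infMul, finsum_eq_single _ n (fun k hk => by rw [ev_of, if_neg hk, mul_zero]),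
    ev_of, if_pos rfl]

theorem ev_mul_u_zero (x : MatAlg α) (m : ℕ) : (x * u α).ev m 0 = 0 := by
  rw [ev_mul, infMul]
  exact finsum_eq_zero_of_forall_eq_zero fun k => by rw [ev_u, if_neg (by omega), mul_zero]

theorem ev_mul_u_succ (x : MatAlg α) (m n : ℕ) :
    (x * u α).ev m (n + 1) = x.ev m n * α^[n + 1] 1 := by
  rw [ev_mul, infMul, finsum_eq_single _ n (fun k hk => by
    rw [ev_u, if_neg (by omega), mul_zero]), ev_u, if_pos rfl]

theorem ev_ext {x y : MatAlg α} (h : ∀ m n, x.ev m n = y.ev m n) : x = y :=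
  ev_injective (funext₂ h)

/-- Under `ev`, right multiplication by `u` shifts the columns by one and multiplies by
`α^(n+1)(1)`. The factor `α^n(1)` already present is absorbed, since the projections `α^n(1)`
decrease. -/
theorem unit_mul_u (i j : ℕ) (x : A) : unit α i j x * u α = unit α i (j + 1) x := by
  refine ev_ext fun m n => ?_
  rcases n with _ | n
  · rw [ev_mul_u_zero, ev_unit, if_neg (by omega)]
  · rw [ev_mul_u_succ, ev_unit, ev_unit]
    by_cases h : m + j = n + i ∧ i ≤ m
    · rw [if_pos h, if_pos (by omega), mul_assoc, iter_one_mul_iter]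
    · rw [if_neg h, if_neg (by omega), zero_mul]

theorem star_u_mul_unit (i j : ℕ) (x : A) : star (u α) * unit α i j x = unit α (i + 1) j x := by
  rw [← star_inj, star_mul, star_star, star_unit, star_unit, unit_mul_u]

theorem unit_eq (i j : ℕ) (x : A) : unit α i j x = star (u α) ^ i * of α x * u α ^ j := by
  induction j with
  | zero =>
    induction i with
    | zero => simp [unit_zero_zero]
    | succ i ih =>
      rw [← star_u_mul_unit, ih, pow_succ' (star (u α))]
      simp only [mul_assoc]
  | succ j ih => rw [← unit_mul_u, ih, pow_succ, ← mul_assoc]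

variable (α) in
/-- The embedding of `A` into the matrix algebra as a `*`-homomorphism. -/
noncomputable def ofHom : A →⋆ₐ[ℂ] MatAlg α where
  toFun := of α
  map_one' := rfl
  map_mul' a b := ev_ext fun m n => by
    rw [ev_mul_of, ev_of, ev_of]
    split_ifs with h
    · rw [h, iter_mul]
    · rw [zero_mul]
  map_zero' := ev_ext fun m n => by rw [ev_of, iterate_map_zero, ite_self, ev_zero]; rfl
  map_add' a b := ev_ext fun m n => by
    rw [ev_add, Matrix.add_apply, ev_of, ev_of, ev_of, iterate_map_add]
    split_ifs <;> simp
  commutes' c := by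
    rw [Algebra.algebraMap_eq_smul_one, Algebra.algebraMap_eq_smul_one]
    refine ext ?_
    change single 0 0 (c • (1 : A)) = c • single 0 0 1
    ext m n
    simp [single]
  map_star' a := by
    rw [← unit_zero_zero, ← unit_zero_zero, star_unit]

theorem ofHom_apply (a : A) : ofHom α a = of α a := rfl

theorem u_mul_of (a : A) : u α * of α a = of α (α a) * u α := by
  refine ev_ext fun m n => ?_
  rw [ev_mul_of, ev_u]
  rcases n with _ | n
  · rw [ev_mul_u_zero, if_neg (by omega), zero_mul]
  · rw [ev_mul_u_succ, ev_of]
    by_cases h : m = n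
    · subst h
      rw [if_pos rfl, if_pos rfl, ← iter_mul, one_mul, ← Function.iterate_succ_apply, ← iter_mul,
        mul_one]
    · rw [if_neg h, if_neg (by omega), zero_mul, zero_mul]

/-- With `u_mul_of` this gives all the relations needed to multiply words `u*^i a u^j`. -/
theorem u_mul_star_u : u α * star (u α) = of α (α 1) := by
  refine ev_ext fun m n => ?_
  rw [ev_mul, ev_star, infMul, finsum_eq_single _ (m + 1) (fun k hk => by
    rw [ev_u, if_neg (by omega), zero_mul]), Matrix.conjTranspose_apply, ev_u, ev_u, if_pos rfl,
    ev_of]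
  by_cases h : m = n
  · subst h
    rw [if_pos rfl, if_pos rfl, iter_one_star, ← iter_mul, one_mul, ← Function.iterate_succ_apply]
  · rw [if_neg h, if_neg (by omega), star_zero, mul_zero]

theorem eq_sum_unit (a : MatAlg α) {N : ℕ} (hN : ∀ m n, (N ≤ m ∨ N ≤ n) → a.val m n = 0) :
    a = ∑ i ∈ Finset.range N, ∑ j ∈ Finset.range N, unit α i j (a.val i j) := by
  let f : MatAlg α →+ Matrix ℕ ℕ A := ⟨⟨val, rfl⟩, val_add⟩
  refine ext ?_
  change a.val = f _
  ext m n
  simp only [map_sum, Matrix.sum_apply]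
  have hf : ∀ i j, f (unit α i j (a.val i j)) m n = if m = i ∧ n = j then a.val i j else 0 :=
    fun i j => by
      have hc := (corner_iff.1 (show Corner α a.val from a.2.2)) i j
      change (unit α i j (a.val i j)).val m n = _
      rw [val_unit, hc.1, hc.2]
      rfl
  simp only [hf]
  rw [Finset.sum_eq_single m]
  · rw [Finset.sum_eq_single n]
    · rw [if_pos ⟨rfl, rfl⟩]
    · intro j _ hj
      rw [if_neg (by simp [hj.symm])]
    · intro h
      rw [if_pos ⟨rfl, rfl⟩, hN m n (by simp at h; omega)]
  · intro i _ hi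
    exact Finset.sum_eq_zero fun j _ => by simp [hi.symm]
  · intro h
    exact Finset.sum_eq_zero fun j _ => by simp [hN m j (by simp at h; omega)]

/-- Additive properties need only be checked on words; identities and norm bounds on the matrix
algebra and its quotient are proved this way. -/
theorem induction_on_unit {p : MatAlg α → Prop} (a : MatAlg α) (zero : p 0)
    (add : ∀ x y, p x → p y → p (x + y)) (hp : ∀ i j x, p (unit α i j x)) : p a := by
  obtain ⟨N, hN⟩ := a.exists_bound
  rw [a.eq_sum_unit hN]
  exact Finset.sum_induction _ p add zero fun i _ =>
    Finset.sum_induction _ p add zero fun j _ => hp i j _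

end MatAlg

end Generators

/-! ### Calculus of words and the integrated form of a covariant pair -/

section Covariant

variable {A : Type u} [CStarAlgebra A] {α : A →⋆ₙₐ[ℂ] A}

section Words

variable {R : Type*} [Ring R] [StarRing R] [Algebra ℂ R] {f : A →⋆ₐ[ℂ] R} {V : R}

/-- The word `V*^i f(x) V^j`. -/
def word (f : A →⋆ₐ[ℂ] R) (V : R) (i j : ℕ) (x : A) : R := star V ^ i * f x * V ^ j

theorem star_word (i j : ℕ) (x : A) : star (word f V i j x) = word f V j i (star x) := by
  simp [word, mul_assoc, map_star]

theorem pow_mul_map (h : ∀ a, V * f a = f (α a) * V) (n : ℕ) (a : A) :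
    V ^ n * f a = f (α^[n] a) * V ^ n := by
  induction n with
  | zero => simp
  | succ n ih => rw [pow_succ', mul_assoc, ih, ← mul_assoc, h, mul_assoc, ← pow_succ',
      Function.iterate_succ_apply']

theorem map_mul_star_pow (h : ∀ a, V * f a = f (α a) * V) (n : ℕ) (a : A) :
    f a * star V ^ n = star V ^ n * f (α^[n] a) := by
  rw [← star_inj]
  simpa [← map_star, iter_star] using pow_mul_map h n (star a)

theorem pow_mul_star_pow (h : ∀ a, V * f a = f (α a) * V) (h1 : V * star V = f (α 1)) (n : ℕ) :
    V ^ n * star V ^ n = f (α^[n] 1) := by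
  induction n with
  | zero => simp
  | succ n ih =>
    rw [pow_succ', pow_succ, mul_assoc, ← mul_assoc (V ^ n), ih, ← mul_assoc, h, mul_assoc, h1,
      ← map_mul, ← map_mul, mul_one, Function.iterate_succ_apply']

/-- Commuting `f 1 = 1` past the powers of `V` shows that they absorb the corner projections, so
compressing the middle factor changes nothing. -/
theorem word_corner (h : ∀ a, V * f a = f (α a) * V) (i j : ℕ) (x : A) :
    word f V i j (α^[i] 1 * x * α^[j] 1) = word f V i j x := by
  have h1 : f (α^[j] 1) * V ^ j = V ^ j := by rw [← pow_mul_map h, map_one, mul_one]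
  have h2 : star V ^ i * f (α^[i] 1) = star V ^ i := by
    rw [← map_mul_star_pow h, map_one, one_mul]
  rw [word, map_mul, map_mul, ← mul_assoc, ← mul_assoc, h2, mul_assoc, h1, word]

/-- The inner factor `V^k V*^k` collapses to `f (α^k(1))`, and the surplus `V^d` is pushed to the
right at the cost of `α^d`. The opposite case, with more adjoints in the middle, follows by taking
adjoints. -/
theorem word_mul_word (h : ∀ a, V * f a = f (α a) * V) (h1 : V * star V = f (α 1))
    (i k d l : ℕ) (x y : A) :
    word f V i (k + d) x * word f V k l y = word f V i (d + l) (x * α^[d] (α^[k] 1 * y)) := by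
  calc word f V i (k + d) x * word f V k l y
      = star V ^ i * f x * (V ^ d * ((V ^ k * star V ^ k) * f y)) * V ^ l := by
        rw [add_comm k d, word, word, pow_add]; simp only [mul_assoc]
    _ = _ := by
        rw [pow_mul_star_pow h h1, ← map_mul, pow_mul_map h, word, pow_add, map_mul]
        simp only [mul_assoc]

theorem word_mul_word' (h : ∀ a, V * f a = f (α a) * V) (h1 : V * star V = f (α 1))
    (i k d l : ℕ) (x y : A) :
    word f V i k x * word f V (k + d) l y = word f V (d + i) l (α^[d] (x * α^[k] 1) * y) := by
  rw [← star_inj, star_mul, star_word, star_word, star_word, word_mul_word h h1, star_mul,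
    ← iter_star, star_mul, iter_one_star]

end Words

theorem MatAlg.unit_eq_word (i j : ℕ) (x : A) :
    unit α i j x = word (ofHom α) (u α) i j x := unit_eq i j x

section

variable {D : Type u} [CStarAlgebra D] {π : A →⋆ₐ[ℂ] D} {U : D}

theorem cstar_norm_one_le (D : Type*) [CStarAlgebra D] : ‖(1 : D)‖ ≤ 1 := by
  rcases subsingleton_or_nontrivial D with h | h
  · rw [Subsingleton.elim (1 : D) 0, norm_zero]; exact zero_le_one
  · exact (CStarRing.norm_one (E := D)).le

/-- Expanding `z z*` for `z = U π(a) - π(α(a)) U` gives four terms, each equal to `π(α(a a*))` up to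
sign, and the signs cancel. The C⋆-identity gives `z = 0`. -/
theorem mul_map_of_conj (h : ∀ a, U * π a * star U = π (α a)) (a : A) :
    U * π a = π (α a) * U := by
  have h1 : U * star U = π (α 1) := by simpa using h 1
  rw [← sub_eq_zero, ← CStarRing.mul_star_self_eq_zero_iff]
  calc (U * π a - π (α a) * U) * star (U * π a - π (α a) * U)
      = U * (π a * π (star a)) * star U - U * π a * star U * π (α (star a))
        - π (α a) * (U * π (star a) * star U) + π (α a) * (U * star U) * π (α (star a)) := by
        simp only [star_sub, star_mul, map_star]; noncomm_ring
    _ = 0 := by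
        rw [h, h, h1, ← map_mul π a, h]
        simp only [← map_mul, mul_one]
        simp

theorem norm_le_one_of_conj (h : ∀ a, U * π a * star U = π (α a)) : ‖U‖ ≤ 1 := by
  have h1 : U * star U = π (α 1) := by simpa using h 1
  have h2 : ‖U‖ * ‖U‖ ≤ 1 := by
    rw [← CStarRing.norm_self_mul_star, h1]
    exact (NonUnitalStarAlgHom.norm_apply_le π _).trans
      ((norm_hom_le _).trans (cstar_norm_one_le A))
  nlinarith [norm_nonneg U]

/-- The sum `∑ U*^m π(a_{m,n}) U^n`. -/
noncomputable def sumWord (π : A →⋆ₐ[ℂ] D) (U : D) (a : MatAlg α) : D :=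
  ∑ᶠ p : ℕ × ℕ, word π U p.1 p.2 (a.val p.1 p.2)

theorem sumWord_eq_sum (a : MatAlg α) {N : ℕ} (hN : ∀ m n, (N ≤ m ∨ N ≤ n) → a.val m n = 0) :
    sumWord π U a = ∑ m ∈ Finset.range N, ∑ n ∈ Finset.range N, word π U m n (a.val m n) := by
  rw [sumWord, finsum_eq_sum_of_support_subset (s := Finset.range N ×ˢ Finset.range N),
    Finset.sum_product]
  intro p hp
  by_contra hc
  refine hp ?_
  simp only [Finset.coe_product, Finset.coe_range, Set.mem_prod, Set.mem_Iio] at hc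
  simp [word, hN p.1 p.2 (by omega)]

theorem sumWord_add (a b : MatAlg α) :
    sumWord π U (a + b) = sumWord π U a + sumWord π U b := by
  obtain ⟨N, ha, hb⟩ := exists_common_bound a b
  rw [sumWord_eq_sum a ha, sumWord_eq_sum b hb, sumWord_eq_sum (a + b) (N := N) fun m n h => by
    rw [MatAlg.val_add, Matrix.add_apply, ha m n h, hb m n h, add_zero]]
  simp only [← Finset.sum_add_distrib]
  refine Finset.sum_congr rfl fun m _ => Finset.sum_congr rfl fun n _ => ?_
  rw [MatAlg.val_add, Matrix.add_apply, word, map_add]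
  simp only [word, mul_add, add_mul]

theorem sumWord_smul (c : ℂ) (a : MatAlg α) : sumWord π U (c • a) = c • sumWord π U a := by
  obtain ⟨N, ha⟩ := a.exists_bound
  rw [sumWord_eq_sum a ha, sumWord_eq_sum (c • a) (N := N) fun m n h => by
    rw [MatAlg.val_smul, Matrix.smul_apply, ha m n h, smul_zero]]
  simp only [Finset.smul_sum]
  refine Finset.sum_congr rfl fun m _ => Finset.sum_congr rfl fun n _ => ?_
  rw [MatAlg.val_smul, Matrix.smul_apply, word, map_smul]
  simp [word]

theorem sumWord_star (a : MatAlg α) : sumWord π U (star a) = star (sumWord π U a) := by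
  obtain ⟨N, ha⟩ := a.exists_bound
  rw [sumWord_eq_sum a ha, sumWord_eq_sum (star a) (N := N) fun m n h => by
    rw [MatAlg.val_star, Matrix.conjTranspose_apply, ha n m h.symm, star_zero], star_sum,
    Finset.sum_comm]
  refine Finset.sum_congr rfl fun m _ => ?_
  rw [star_sum]
  refine Finset.sum_congr rfl fun n _ => ?_
  rw [star_word, MatAlg.val_star, Matrix.conjTranspose_apply]

theorem sumWord_zero : sumWord π U (0 : MatAlg α) = 0 := by
  simpa using sumWord_smul (π := π) (U := U) 0 (0 : MatAlg α)

theorem sumWord_unit (h : ∀ a, U * π a * star U = π (α a)) (i j : ℕ) (x : A) :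
    sumWord π U (MatAlg.unit α i j x) = word π U i j x := by
  rw [sumWord, finsum_eq_single _ (i, j)]
  · rw [MatAlg.val_unit, single, if_pos ⟨rfl, rfl⟩, word_corner (mul_map_of_conj h)]
  · intro p hp
    rw [MatAlg.val_unit, single, if_neg fun hc => hp (Prod.ext hc.1 hc.2)]
    simp [word]

/-- By additivity both factors may be taken to be words. The pairs `(ofHom α, u α)` and `(π, U)`
satisfy the same relations, so one product formula applies in both algebras and the convolution
product need not be expanded. -/
theorem sumWord_mul (h : ∀ a, U * π a * star U = π (α a)) (a b : MatAlg α) :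
    sumWord π U (a * b) = sumWord π U a * sumWord π U b := by
  have h1 : U * star U = π (α 1) := by simpa using h 1
  refine MatAlg.induction_on_unit
    (p := fun a => sumWord π U (a * b) = sumWord π U a * sumWord π U b) a ?_ (fun x y hx hy => ?_) fun i j x => ?_
  · rw [zero_mul, sumWord_zero, zero_mul]
  · rw [add_mul, sumWord_add, sumWord_add, hx, hy, add_mul]
  refine MatAlg.induction_on_unit (p := fun b => sumWord π U (MatAlg.unit α i j x * b) =
    sumWord π U (MatAlg.unit α i j x) * sumWord π U b) b ?_ (fun y z hy hz => ?_) fun k l y => ?_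
  · rw [mul_zero, sumWord_zero, mul_zero]
  · rw [mul_add, sumWord_add, sumWord_add, hy, hz, mul_add]
  have hS : ∀ a, MatAlg.u α * MatAlg.ofHom α a = MatAlg.ofHom α (α a) * MatAlg.u α :=
    MatAlg.u_mul_of
  rw [sumWord_unit h, sumWord_unit h]
  rcases le_total k j with hkj | hkj
  · obtain ⟨d, rfl⟩ := Nat.exists_eq_add_of_le hkj
    rw [MatAlg.unit_eq_word, MatAlg.unit_eq_word, word_mul_word hS MatAlg.u_mul_star_u,
      ← MatAlg.unit_eq_word, sumWord_unit h, word_mul_word (mul_map_of_conj h) h1]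
  · obtain ⟨d, rfl⟩ := Nat.exists_eq_add_of_le hkj
    rw [MatAlg.unit_eq_word, MatAlg.unit_eq_word, word_mul_word' hS MatAlg.u_mul_star_u,
      ← MatAlg.unit_eq_word, sumWord_unit h, word_mul_word' (mul_map_of_conj h) h1]

theorem sumWord_of (h : ∀ a, U * π a * star U = π (α a)) (a : A) :
    sumWord π U (MatAlg.of α a) = π a := by
  rw [← MatAlg.unit_zero_zero, sumWord_unit h]
  simp [word]

theorem sumWord_u (h : ∀ a, U * π a * star U = π (α a)) : sumWord π U (MatAlg.u α) = U := by
  rw [← MatAlg.unit_zero_one, sumWord_unit h]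
  simp [word]

/-- The `*`-homomorphism `a ↦ ∑ U*^m π(a_{m,n}) U^n` integrating a covariant pair. -/
noncomputable def integrate (h : ∀ a, U * π a * star U = π (α a)) : MatAlg α →⋆ₐ[ℂ] D where
  toFun := sumWord π U
  map_one' := by
    rw [show (1 : MatAlg α) = MatAlg.of α 1 from rfl, sumWord_of h, map_one]
  map_mul' := sumWord_mul h
  map_zero' := sumWord_zero
  map_add' := sumWord_add
  commutes' c := by
    rw [Algebra.algebraMap_eq_smul_one, Algebra.algebraMap_eq_smul_one, sumWord_smul,
      show (1 : MatAlg α) = MatAlg.of α 1 from rfl, sumWord_of h, map_one]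
  map_star' := sumWord_star

end

end Covariant

/-! ### Covariant representations vanish on the null ideal -/

section QuotientLift

variable {A : Type u} [CStarAlgebra A] {α : A →⋆ₙₐ[ℂ] A} {J : TwoSidedIdeal A}
  {D : Type u} [CStarAlgebra D]

variable (α J) in
/-- The quotient map as a `*`-homomorphism. -/
noncomputable def MatQuot.mkHom : MatAlg α →⋆ₐ[ℂ] MatQuot α J where
  toFun := mk J
  map_one' := rfl
  map_mul' _ _ := rfl
  map_zero' := rfl
  map_add' _ _ := rfl
  commutes' _ := rfl
  map_star' _ := rfl

theorem MatQuot.mkHom_apply (a : MatAlg α) : mkHom α J a = mk J a := rfl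

/-- A `*`-homomorphism killing the null ideal factors through the quotient. -/
theorem MatQuot.exists_lift (Φ : MatAlg α →⋆ₐ[ℂ] D) (h : ∀ a ∈ nullIdeal α J, Φ a = 0) :
    ∃ Ψ : MatQuot α J →⋆ₐ[ℂ] D, ∀ a, Ψ (mk J a) = Φ a := by
  obtain ⟨F, hF⟩ : ∃ F : MatQuot α J → D, ∀ a, F (mkHom α J a) = Φ a := by
    refine ⟨fun x => Φ (Function.surjInv mk_surjective x), fun a => ?_⟩
    rw [← sub_eq_zero, ← map_sub]
    refine h _ (mem_nullIdeal.2 (mk_eq_mk.1 ?_))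
    exact Function.surjInv_eq mk_surjective (mk J a)
  have hs : Function.Surjective (mkHom α J) := mk_surjective
  refine ⟨
    { toFun := F
      map_one' := by rw [← map_one (mkHom α J), hF, map_one]
      map_mul' := fun x y => by
        obtain ⟨a, rfl⟩ := hs x
        obtain ⟨b, rfl⟩ := hs y
        rw [← map_mul, hF, hF, hF, map_mul]
      map_zero' := by rw [← map_zero (mkHom α J), hF, map_zero]
      map_add' := fun x y => by
        obtain ⟨a, rfl⟩ := hs x
        obtain ⟨b, rfl⟩ := hs y
        rw [← map_add, hF, hF, hF, map_add]
      commutes' := fun c => by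
        rw [← AlgHomClass.commutes (mkHom α J), hF, AlgHomClass.commutes Φ]
      map_star' := fun x => by
        obtain ⟨a, rfl⟩ := hs x
        rw [← map_star, hF, hF, map_star] }, hF⟩

variable {π : A →⋆ₐ[ℂ] D} {U : D}

/-- The left side is `U*U π(x) U*U`. A closed ideal is self-adjoint, so `U*U` acts as an identity on
`π(x)` from both sides. Thus a word with middle factor `x` in `J` may be moved one step down its
diagonal, which drives the telescoping. -/
theorem star_mul_map_mul (hJ : IsClosed (J : Set A)) (h : IsCovariantRep α J π U) {x : A}
    (hx : x ∈ J) : star U * π (α x) * U = π x := by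
  have hx' : star x ∈ J := by
    have := star_mem_closure J hx
    rwa [hJ.closure_eq] at this
  have h1 : π x * (star U * U) = π x := by
    rw [← star_inj]
    simpa [← map_star, mul_assoc] using (h.ideal _).1 hx'
  calc star U * π (α x) * U = star U * U * π x * (star U * U) := by
        rw [← h.conj]; simp only [mul_assoc]
    _ = π x := by rw [(h.ideal x).1 hx, h1]

theorem norm_word_le (hU : ‖U‖ ≤ 1) (m n : ℕ) (x : A) : ‖word π U m n x‖ ≤ ‖x‖ := by
  have hp : ∀ V : D, ‖V‖ ≤ 1 → ∀ n, ‖V ^ n‖ ≤ 1 := fun V hV n => by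
    induction n with
    | zero => rw [pow_zero]; exact cstar_norm_one_le D
    | succ n ih =>
      rw [pow_succ]
      exact (norm_mul_le _ _).trans (mul_le_one₀ ih (norm_nonneg _) hV)
  have h1 : ‖π x‖ ≤ ‖x‖ := NonUnitalStarAlgHom.norm_apply_le π x
  calc ‖word π U m n x‖ ≤ ‖star U ^ m‖ * ‖π x‖ * ‖U ^ n‖ :=
        (norm_mul_le _ _).trans (mul_le_mul_of_nonneg_right (norm_mul_le _ _) (norm_nonneg _))
    _ ≤ 1 * ‖x‖ * 1 := by
        gcongr
        · exact hp _ (by rwa [norm_star]) m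
        · exact hp _ hU n
    _ = ‖x‖ := by ring

/-- Write `a = E - Λ(E)` with `E = a.ev`. Summed over the square of indices up to `M`, the words of
`Λ(E)` equal the words of `E` over the square of indices below `M`. The difference is the last row
and column. -/
theorem sumWord_eq_of_mem (hJ : IsClosed (J : Set A)) (h : IsCovariantRep α J π U) {a : MatAlg α}
    (ha : ∀ m n, a.ev m n ∈ J) {N M : ℕ} (hN : ∀ m n, (N ≤ m ∨ N ≤ n) → a.val m n = 0)
    (hM : N ≤ M) : sumWord π U a = ∑ n ∈ Finset.range M, word π U M n (a.ev M n) +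
      ∑ m ∈ Finset.range (M + 1), word π U m M (a.ev m M) := by
  have h0 : ∀ m n, a.ev m n = a.val m n + Lam α a.ev m n := fun m n =>
    congrFun₂ (lamSum_zero (α := α) a.val) m n
  have hadd : ∀ m n (x y : A), word π U m n (x + y) = word π U m n x + word π U m n y :=
    fun m n x y => by simp [word, mul_add, add_mul]
  have hstep : ∀ m n, word π U (m + 1) (n + 1) (Lam α a.ev (m + 1) (n + 1)) =
      word π U m n (a.ev m n) := fun m n => by
    rw [Lam_succ, word, word, ← star_mul_map_mul hJ h (ha m n), pow_succ (star U), pow_succ' U]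
    simp only [mul_assoc]
  have hz : ∀ m n, word π U m n (0 : A) = 0 := fun m n => by simp [word]
  have key : ∑ m ∈ Finset.range (M + 1), ∑ n ∈ Finset.range (M + 1), word π U m n (a.ev m n) =
      sumWord π U a + ∑ m ∈ Finset.range M, ∑ n ∈ Finset.range M, word π U m n (a.ev m n) := by
    rw [sumWord_eq_sum a (N := M + 1) fun m n hmn => hN m n (by omega)]
    have : ∑ m ∈ Finset.range M, ∑ n ∈ Finset.range M, word π U m n (a.ev m n) =
        ∑ m ∈ Finset.range (M + 1), ∑ n ∈ Finset.range (M + 1),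
          word π U m n (Lam α a.ev m n) := by
      rw [Finset.sum_range_succ']
      simp only [Lam_zero_left, hz, Finset.sum_const_zero, add_zero]
      refine Finset.sum_congr rfl fun m _ => ?_
      rw [Finset.sum_range_succ', Lam_zero_right, hz, add_zero]
      exact Finset.sum_congr rfl fun n _ => (hstep m n).symm
    rw [this, ← Finset.sum_add_distrib]
    refine Finset.sum_congr rfl fun m _ => ?_
    rw [← Finset.sum_add_distrib]
    exact Finset.sum_congr rfl fun n _ => by rw [← hadd, ← h0]
  rw [← add_left_inj, ← key, Finset.sum_range_succ]
  simp only [Finset.sum_range_succ, Finset.sum_add_distrib]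
  abel

/-- The boundary sum is independent of the size of the square. Because `a.ev` is banded, at most `2
* N + 1` boundary terms remain, each running down a fixed diagonal of `a.ev`, hence tending to zero.
-/
theorem sumWord_eq_zero (hJ : IsClosed (J : Set A)) (h : IsCovariantRep α J π U) {a : MatAlg α}
    (ha : a ∈ nullIdeal α J) : sumWord π U a = 0 := by
  rw [mem_nullIdeal, MatAlg.seminorm_eq_zero_iff, hJ.closure_eq] at ha
  obtain ⟨N, hN⟩ := a.exists_bound
  have hU := norm_le_one_of_conj h.conj
  have hz : ∀ m n, word π U m n (0 : A) = 0 := fun m n => by simp [word]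
  have hband : ∀ m n, (m + N ≤ n ∨ n + N ≤ m) → a.ev m n = 0 := fun m n => lamSum_band hN m n
  have h1 : ∀ i, sumWord π U a =
      ∑ n ∈ Finset.range N, word π U (i + N) (i + n) (a.ev (i + N) (i + n)) +
      ∑ m ∈ Finset.range (N + 1), word π U (i + m) (i + N) (a.ev (i + m) (i + N)) := fun i => by
    have e1 : ∑ n ∈ Finset.range i, word π U (i + N) n (a.ev (i + N) n) = 0 :=
      Finset.sum_eq_zero fun n hn => by
        rw [hband _ _ (Or.inr (by have := Finset.mem_range.1 hn; omega)), hz]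
    have e2 : ∑ m ∈ Finset.range i, word π U m (i + N) (a.ev m (i + N)) = 0 :=
      Finset.sum_eq_zero fun m hm => by
        rw [hband _ _ (Or.inl (by have := Finset.mem_range.1 hm; omega)), hz]
    rw [sumWord_eq_of_mem hJ h ha.1 hN (Nat.le_add_left N i), Finset.sum_range_add, add_assoc i,
      Finset.sum_range_add, e1, e2, zero_add, zero_add]
  have h2 : ∀ p q, Tendsto (fun i => word π U (i + p) (i + q) (a.ev (i + p) (i + q))) atTop (𝓝 0) :=
    fun p q => squeeze_zero_norm (fun i => norm_word_le hU _ _ _) (by simpa using (ha.2 p q).norm)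
  have h3 := (tendsto_finsetSum (Finset.range N) fun n _ => h2 N n).add
    (tendsto_finsetSum (Finset.range (N + 1)) fun m _ => h2 m N)
  simp only [← h1, Finset.sum_const_zero, add_zero] at h3
  exact tendsto_nhds_unique tendsto_const_nhds h3

/-- Every `J`-covariant representation integrates to the quotient of the matrix algebra. -/
theorem IsCovariantRep.exists_integrate (hJ : IsClosed (J : Set A)) (h : IsCovariantRep α J π U) :
    ∃ Ψ : MatQuot α J →⋆ₐ[ℂ] D, (∀ a, Ψ (MatQuot.mk J (MatAlg.of α a)) = π a) ∧
      Ψ (MatQuot.mk J (MatAlg.u α)) = U := by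
  obtain ⟨Ψ, hΨ⟩ := MatQuot.exists_lift (integrate h.conj) fun a ha => sumWord_eq_zero hJ h ha
  exact ⟨Ψ, fun a => (hΨ _).trans (sumWord_of h.conj a), (hΨ _).trans (sumWord_u h.conj)⟩

end QuotientLift

/-! ### The `A`-valued inner product on rows -/

section Toeplitz

open scoped ComplexOrder

attribute [local instance] CStarAlgebra.spectralOrder CStarAlgebra.spectralOrderedRing

variable {A : Type u} [CStarAlgebra A] {α : A →⋆ₙₐ[ℂ] A}

namespace MatAlg

theorem ev_sub (x y : MatAlg α) : (x - y).ev = x.ev - y.ev := by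
  rw [sub_eq_add_neg, ev_add, ev_neg, ← sub_eq_add_neg]

theorem ev_of_mul (a : A) (x : MatAlg α) (m n : ℕ) :
    (of α a * x).ev m n = α^[m] a * x.ev m n := by
  rw [ev_mul, infMul, finsum_eq_single _ m (fun k hk => by rw [ev_of, if_neg hk.symm, zero_mul]),
    ev_of, if_pos rfl]

theorem ev_u_mul (x : MatAlg α) (m n : ℕ) : (u α * x).ev m n = x.ev (m + 1) n := by
  rw [ev_mul, infMul, finsum_eq_single _ (m + 1) (fun k hk => by
    rw [ev_u, if_neg hk, zero_mul]), ev_u, if_pos rfl, (corner_iff.1 x.ev_corner _ _).1]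

theorem ev_u_pow_mul (k : ℕ) (x : MatAlg α) (m n : ℕ) :
    (u α ^ k * x).ev m n = x.ev (m + k) n := by
  induction k generalizing m with
  | zero => simp
  | succ k ih => rw [pow_succ', mul_assoc, ev_u_mul, ih]; congr 1; omega

theorem ev_mul_star_u_pow (k : ℕ) (x : MatAlg α) (m n : ℕ) :
    (x * star (u α ^ k)).ev m n = x.ev m (n + k) := by
  have := congrArg star (ev_u_pow_mul k (star x) n m)
  rw [ev_star, Matrix.conjTranspose_apply, star_star] at this
  rw [← this, ← Matrix.conjTranspose_apply, ← ev_star, star_mul, star_star]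

/-- The `A`-valued inner product of the rows number `0` of two matrices. -/
noncomputable def rowInner (x y : MatAlg α) : A := (x * star y).ev 0 0

theorem rowInner_add_left (x y z : MatAlg α) :
    rowInner (x + y) z = rowInner x z + rowInner y z := by
  rw [rowInner, add_mul, ev_add]; rfl

theorem star_rowInner (x y : MatAlg α) : star (rowInner x y) = rowInner y x := by
  rw [rowInner, ← Matrix.conjTranspose_apply, ← ev_star, star_mul, star_star, rowInner]

theorem rowInner_add_right (x y z : MatAlg α) :
    rowInner x (y + z) = rowInner x y + rowInner x z := by
  rw [← star_rowInner, rowInner_add_left, star_add, star_rowInner, star_rowInner]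

theorem rowInner_smul_left (c : ℂ) (x y : MatAlg α) : rowInner (c • x) y = c • rowInner x y := by
  rw [rowInner, smul_mul_assoc, ev_smul]; rfl

theorem rowInner_smul_right (c : ℂ) (x y : MatAlg α) :
    rowInner x (c • y) = star c • rowInner x y := by
  rw [← star_rowInner, rowInner_smul_left, star_smul, star_rowInner]

theorem rowInner_of_mul_left (a : A) (x y : MatAlg α) :
    rowInner (of α a * x) y = a * rowInner x y := by
  rw [rowInner, mul_assoc, ev_of_mul]; rfl

theorem rowInner_of_mul_right (a : A) (x y : MatAlg α) :
    rowInner x (of α a * y) = rowInner x y * star a := by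
  rw [← star_rowInner, rowInner_of_mul_left, star_mul, star_rowInner]

theorem rowInner_mul_left (x s y : MatAlg α) : rowInner (x * s) y = rowInner x (y * star s) := by
  rw [rowInner, rowInner, star_mul, star_star, mul_assoc]

theorem rowInner_self_eq_sum (x : MatAlg α) {K : ℕ} (hK : ∀ k, K ≤ k → x.ev 0 k = 0) :
    rowInner x x = ∑ k ∈ Finset.range K, x.ev 0 k * star (x.ev 0 k) := by
  rw [rowInner, ev_mul, infMul_eq_sum _ hK, ev_star]
  simp only [Matrix.conjTranspose_apply]

theorem rowInner_self_nonneg (x : MatAlg α) : 0 ≤ rowInner x x := by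
  obtain ⟨K, hK⟩ := x.ev_rowFin 0
  rw [rowInner_self_eq_sum x hK]
  exact Finset.sum_nonneg fun k _ => mul_star_self_nonneg _

/-- Cauchy–Schwarz for a Hilbert module: expand `0 ≤ ⟨a x - t y, a x - t y⟩` with `a = ⟨y, x⟩` and
use `a ⟨x, x⟩ a* ≤ t a a*`, leaving `a a* ≤ t ⟨y, y⟩`. The real `t` is taken strictly above `‖⟨x,
x⟩‖`, so that it is positive and can be cancelled, and then tends to that value. -/
theorem norm_rowInner_sq_le (x y : MatAlg α) :
    ‖rowInner x y‖ ^ 2 ≤ ‖rowInner x x‖ * ‖rowInner y y‖ := by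
  have key : ∀ t > ‖rowInner x x‖, ‖rowInner x y‖ ^ 2 ≤ t * ‖rowInner y y‖ := fun t ht => by
    have ht0 : 0 < t := (norm_nonneg _).trans_lt ht
    set a := rowInner y x with ha
    have hxy : rowInner x y = star a := (star_rowInner y x).symm
    have h1 : 0 ≤ a * rowInner x x * star a - t • (a * star a) - t • (a * star a)
        + t • t • rowInner y y := by
      have := rowInner_self_nonneg (of α a * x + (-t : ℂ) • y)
      rw [rowInner_add_left, rowInner_add_right, rowInner_add_right, rowInner_smul_left,
        rowInner_smul_left, rowInner_smul_right, rowInner_smul_right, rowInner_of_mul_left,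
        rowInner_of_mul_left, rowInner_of_mul_right, rowInner_of_mul_right, hxy, ← ha] at this
      refine this.trans_eq ?_
      have e : star (-t : ℂ) = -t := by simp
      simp only [e, neg_smul, smul_neg, neg_neg, Complex.coe_smul, mul_assoc]
      abel
    have h2 : a * rowInner x x * star a ≤ t • (a * star a) :=
      (CStarAlgebra.star_right_conjugate_le_norm_smul
        (hb := IsSelfAdjoint.of_nonneg (rowInner_self_nonneg x))).trans
        (smul_le_smul_of_nonneg_right ht.le (mul_star_self_nonneg a))
    have h3 : t • (a * star a) ≤ t • t • rowInner y y := by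
      have : 0 ≤ t • t • rowInner y y - t • (a * star a) :=
        h1.trans (by
          have := sub_nonneg.2 h2
          rw [← sub_nonneg]
          refine this.trans_eq ?_
          abel)
      exact sub_nonneg.1 this
    have h4 : a * star a ≤ t • rowInner y y := (smul_le_smul_iff_of_pos_left ht0).1 h3
    have h5 := CStarAlgebra.norm_le_norm_of_nonneg_of_le (mul_star_self_nonneg a) h4
    rwa [CStarRing.norm_self_mul_star, norm_smul, Real.norm_of_nonneg ht0.le, ← sq, ha,
      ← star_rowInner, norm_star] at h5
  have hc : Tendsto (fun t : ℝ => t * ‖rowInner y y‖) (𝓝[>] ‖rowInner x x‖)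
      (𝓝 (‖rowInner x x‖ * ‖rowInner y y‖)) :=
    (Continuous.tendsto (by fun_prop) _).mono_left nhdsWithin_le_nhds
  exact ge_of_tendsto hc (eventually_nhdsWithin_of_forall key)

end MatAlg

end Toeplitz

/-! ### The C⋆-seminorm of matrices acting on rows -/

section Toeplitz

open scoped ComplexOrder

attribute [local instance] CStarAlgebra.spectralOrder CStarAlgebra.spectralOrderedRing

variable {A : Type u} [CStarAlgebra A] {α : A →⋆ₙₐ[ℂ] A}

variable (α) in
/-- The matrix algebra with the seminorm given by the norm of the row number `0`. -/
def RowSpace : Type u := MatAlg α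

namespace RowSpace

noncomputable instance : AddCommGroup (RowSpace α) := inferInstanceAs (AddCommGroup (MatAlg α))

noncomputable instance : Module ℂ (RowSpace α) := inferInstanceAs (Module ℂ (MatAlg α))

variable (α) in
/-- The identity map to the row space. -/
noncomputable def equiv : MatAlg α ≃ₗ[ℂ] RowSpace α := LinearEquiv.refl ℂ _

noncomputable instance : Norm (RowSpace α) :=
  ⟨fun x => √‖MatAlg.rowInner ((equiv α).symm x) ((equiv α).symm x)‖⟩

theorem norm_sq (x : MatAlg α) : ‖equiv α x‖ ^ 2 = ‖MatAlg.rowInner x x‖ :=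
  Real.sq_sqrt (norm_nonneg _)

theorem norm_rowInner_le (x y : MatAlg α) :
    ‖MatAlg.rowInner x y‖ ≤ ‖equiv α x‖ * ‖equiv α y‖ := by
  refine le_of_sq_le_sq ?_ (mul_nonneg (Real.sqrt_nonneg _) (Real.sqrt_nonneg _))
  rw [mul_pow, norm_sq, norm_sq]
  exact MatAlg.norm_rowInner_sq_le x y

theorem core : SeminormedSpace.Core ℂ (RowSpace α) where
  norm_nonneg _ := Real.sqrt_nonneg _
  norm_smul c x := by
    obtain ⟨x, rfl⟩ := (equiv α).surjective x
    have h0 : ∀ y : MatAlg α, 0 ≤ ‖equiv α y‖ := fun y => Real.sqrt_nonneg _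
    rw [← map_smul, ← sq_eq_sq₀ (h0 _) (mul_nonneg (norm_nonneg _) (h0 _)), mul_pow, norm_sq,
      norm_sq,
      MatAlg.rowInner_smul_left, MatAlg.rowInner_smul_right, norm_smul, norm_smul, norm_star]
    ring
  norm_triangle x y := by
    obtain ⟨x, rfl⟩ := (equiv α).surjective x
    obtain ⟨y, rfl⟩ := (equiv α).surjective y
    rw [← map_add]
    refine le_of_sq_le_sq ?_ (add_nonneg (Real.sqrt_nonneg _) (Real.sqrt_nonneg _))
    rw [add_sq, norm_sq, norm_sq, norm_sq, MatAlg.rowInner_add_left, MatAlg.rowInner_add_right,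
      MatAlg.rowInner_add_right]
    have h1 := norm_add_le (MatAlg.rowInner x x + MatAlg.rowInner x y)
      (MatAlg.rowInner y x + MatAlg.rowInner y y)
    have h2 := norm_add_le (MatAlg.rowInner x x) (MatAlg.rowInner x y)
    have h3 := norm_add_le (MatAlg.rowInner y x) (MatAlg.rowInner y y)
    have h4 := norm_rowInner_le x y
    have h5 := norm_rowInner_le y x
    linarith

noncomputable instance : SeminormedAddCommGroup (RowSpace α) := SeminormedAddCommGroup.ofCore core

noncomputable instance : NormedSpace ℂ (RowSpace α) where
  norm_smul_le c x := (core.norm_smul c x).le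

/-- Right multiplication. -/
noncomputable def mulRight (s : MatAlg α) : RowSpace α →ₗ[ℂ] RowSpace α where
  toFun x := equiv α ((equiv α).symm x * s)
  map_add' x y := by simp [add_mul]
  map_smul' c x := by simp

theorem norm_mul_sq_le (x s : MatAlg α) :
    ‖equiv α (x * s)‖ ^ 2 ≤ ‖equiv α (x * (s * star s))‖ * ‖equiv α x‖ := by
  rw [norm_sq, ← MatAlg.star_rowInner, MatAlg.rowInner_mul_left, ← MatAlg.star_rowInner,
    star_star, mul_assoc]
  exact norm_rowInner_le _ _

/-- Row `0` of `x a` has entries `x_k α^k(a)`, and `x_k α^k(a) α^k(a)* x_k* ≤ ‖a‖² x_k x_k*`. The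
norm is monotone on positive elements. -/
theorem norm_mul_of_le (x : MatAlg α) (a : A) :
    ‖equiv α (x * MatAlg.of α a)‖ ≤ ‖a‖ * ‖equiv α x‖ := by
  refine le_of_sq_le_sq ?_ (mul_nonneg (norm_nonneg _) (norm_nonneg _))
  obtain ⟨K, hK⟩ := x.ev_rowFin 0
  rw [mul_pow, norm_sq, norm_sq, MatAlg.rowInner_self_eq_sum x hK,
    MatAlg.rowInner_self_eq_sum (x * MatAlg.of α a) (K := K) fun k hk => by
      rw [MatAlg.ev_mul_of, hK k hk, zero_mul]]
  have h1 : ∀ k, (x * MatAlg.of α a).ev 0 k * star ((x * MatAlg.of α a).ev 0 k) ≤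
      ‖a‖ ^ 2 • (x.ev 0 k * star (x.ev 0 k)) := fun k => by
    rw [MatAlg.ev_mul_of, star_mul, mul_assoc, ← mul_assoc (α^[k] a), ← mul_assoc]
    refine (CStarAlgebra.star_right_conjugate_le_norm_smul
      (hb := IsSelfAdjoint.mul_star_self _)).trans (smul_le_smul_of_nonneg_right ?_ (mul_star_self_nonneg _))
    rw [CStarRing.norm_self_mul_star, ← sq]
    exact pow_le_pow_left₀ (norm_nonneg _) (norm_iter_le k a) 2
  have h2 := Finset.sum_le_sum fun k (_ : k ∈ Finset.range K) => h1 k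
  rw [← Finset.smul_sum] at h2
  refine (CStarAlgebra.norm_le_norm_of_nonneg_of_le
    (Finset.sum_nonneg fun k _ => mul_star_self_nonneg _) h2).trans_eq ?_
  rw [norm_smul, Real.norm_of_nonneg (by positivity)]

/-- Right multiplication by any matrix is bounded. -/
theorem exists_norm_mul_le (s : MatAlg α) :
    ∃ C : ℝ, ∀ x, ‖equiv α (x * s)‖ ≤ C * ‖equiv α x‖ := by
  have hmul : ∀ s t : MatAlg α, (∃ C : ℝ, 0 ≤ C ∧ ∀ x, ‖equiv α (x * s)‖ ≤ C * ‖equiv α x‖) →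
      (∃ C : ℝ, 0 ≤ C ∧ ∀ x, ‖equiv α (x * t)‖ ≤ C * ‖equiv α x‖) →
      ∃ C : ℝ, 0 ≤ C ∧ ∀ x, ‖equiv α (x * (s * t))‖ ≤ C * ‖equiv α x‖ := by
    rintro s t ⟨C, hC0, hC⟩ ⟨C', hC0', hC'⟩
    refine ⟨C' * C, mul_nonneg hC0' hC0, fun x => ?_⟩
    rw [← mul_assoc, mul_assoc C']
    exact (hC' _).trans (mul_le_mul_of_nonneg_left (hC x) hC0')
  have hu : ∀ x, ‖equiv α (x * MatAlg.u α)‖ ≤ 1 * ‖equiv α x‖ := fun x => by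
    refine le_of_sq_le_sq ((norm_mul_sq_le _ _).trans ?_)
      (mul_nonneg zero_le_one (norm_nonneg _))
    rw [MatAlg.u_mul_star_u, one_mul, sq]
    refine mul_le_mul_of_nonneg_right ((norm_mul_of_le _ _).trans ?_) (norm_nonneg _)
    exact mul_le_of_le_one_left (norm_nonneg _) ((norm_hom_le _).trans (cstar_norm_one_le A))
  -- Here `‖x u*‖² ≤ ‖x u* u‖ ‖x‖ ≤ ‖x u*‖ ‖x‖` by the bound for `u`, and one factor cancels.
  have hu' : ∀ x, ‖equiv α (x * star (MatAlg.u α))‖ ≤ 1 * ‖equiv α x‖ := fun x => by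
    have h1 := norm_mul_sq_le x (star (MatAlg.u α))
    rw [star_star, ← mul_assoc] at h1
    have h2 := hu (x * star (MatAlg.u α))
    have h3 : 0 ≤ ‖equiv α x‖ := norm_nonneg _
    have h4 : 0 ≤ ‖equiv α (x * star (MatAlg.u α))‖ := norm_nonneg _
    by_contra! hc
    nlinarith
  have hpow : ∀ s : MatAlg α, (∃ C : ℝ, 0 ≤ C ∧ ∀ x, ‖equiv α (x * s)‖ ≤ C * ‖equiv α x‖) →
      ∀ n : ℕ, ∃ C : ℝ, 0 ≤ C ∧ ∀ x, ‖equiv α (x * s ^ n)‖ ≤ C * ‖equiv α x‖ := fun s hs n => by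
    induction n with
    | zero => exact ⟨1, zero_le_one, fun x => by simp⟩
    | succ n ih => rw [pow_succ]; exact hmul _ _ ih hs
  refine MatAlg.induction_on_unit
    (p := fun s => ∃ C : ℝ, ∀ x, ‖equiv α (x * s)‖ ≤ C * ‖equiv α x‖) s ⟨0, fun x => by simp⟩ ?_ ?_
  · rintro s t ⟨C, hC⟩ ⟨C', hC'⟩
    refine ⟨C + C', fun x => ?_⟩
    rw [mul_add, map_add, add_mul]
    exact (norm_add_le _ _).trans (add_le_add (hC x) (hC' x))
  · intro i j a
    rw [MatAlg.unit_eq]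
    obtain ⟨C, -, hC⟩ := hmul _ _ (hmul _ _ (hpow _ ⟨1, zero_le_one, hu'⟩ i)
      ⟨‖a‖, norm_nonneg a, fun x => norm_mul_of_le x a⟩) (hpow _ ⟨1, zero_le_one, hu⟩ j)
    exact ⟨C, hC⟩

/-- Right multiplication as a bounded operator. -/
noncomputable def mulRightL (s : MatAlg α) : RowSpace α →L[ℂ] RowSpace α :=
  (mulRight s).mkContinuousOfExistsBound
    ((exists_norm_mul_le s).imp fun _ hC x => hC ((equiv α).symm x))

theorem norm_mul_le (x s : MatAlg α) : ‖equiv α (x * s)‖ ≤ ‖mulRightL s‖ * ‖equiv α x‖ :=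
  (mulRightL s).le_opNorm (equiv α x)

theorem norm_mulRightL_le (s : MatAlg α) {C : ℝ} (hC : 0 ≤ C)
    (h : ∀ x, ‖equiv α (x * s)‖ ≤ C * ‖equiv α x‖) : ‖mulRightL s‖ ≤ C :=
  (mulRightL s).opNorm_le_bound hC fun x => h ((equiv α).symm x)

variable (α) in
/-- The norm of the matrices as operators on the rows. -/
noncomputable def opSeminorm : Seminorm ℂ (MatAlg α) :=
  Seminorm.of (fun s => ‖mulRightL s‖)
    (fun s t => norm_mulRightL_le _ (add_nonneg (norm_nonneg _) (norm_nonneg _)) fun x => by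
      rw [mul_add, map_add, add_mul]
      exact (norm_add_le _ _).trans (add_le_add (norm_mul_le x s) (norm_mul_le x t)))
    (fun c s => by
      have : mulRightL (c • s) = c • mulRightL s := by
        ext x
        change equiv α ((equiv α).symm x * (c • s)) = c • equiv α ((equiv α).symm x * s)
        rw [mul_smul_comm, map_smul]
      rw [this, norm_smul])

theorem opSeminorm_mul_le (s t : MatAlg α) :
    opSeminorm α (s * t) ≤ opSeminorm α s * opSeminorm α t := by
  refine norm_mulRightL_le (s * t) (mul_nonneg (apply_nonneg _ s) (apply_nonneg _ t)) fun x => ?_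
  calc ‖equiv α (x * (s * t))‖ = ‖equiv α (x * s * t)‖ := by rw [mul_assoc]
    _ ≤ opSeminorm α t * ‖equiv α (x * s)‖ := norm_mul_le _ _
    _ ≤ opSeminorm α t * (opSeminorm α s * ‖equiv α x‖) :=
        mul_le_mul_of_nonneg_left (norm_mul_le x s) (apply_nonneg _ t)
    _ = _ := by ring

/-- Right multiplication reverses products, so the inner product gives the C⋆-inequality for `s *
star s`. It implies `‖s‖ ≤ ‖s*‖`, and applying it to `star s` turns it into the required form. -/
theorem opSeminorm_mul_self_le (s : MatAlg α) :
    opSeminorm α s * opSeminorm α s ≤ opSeminorm α (star s * s) := by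
  have h1 : ∀ s : MatAlg α, opSeminorm α s ^ 2 ≤ opSeminorm α (s * star s) := fun s => by
    rw [← Real.le_sqrt (apply_nonneg _ _) (apply_nonneg _ _)]
    refine norm_mulRightL_le s (Real.sqrt_nonneg _) fun x => ?_
    refine le_of_sq_le_sq ?_ (mul_nonneg (Real.sqrt_nonneg _) (norm_nonneg _))
    rw [mul_pow, Real.sq_sqrt (apply_nonneg _ _), sq ‖equiv α x‖, ← mul_assoc]
    exact (norm_mul_sq_le x s).trans
      (mul_le_mul_of_nonneg_right (norm_mul_le _ _) (norm_nonneg _))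
  have h2 : opSeminorm α s ≤ opSeminorm α (star s) := by
    have := (h1 s).trans (opSeminorm_mul_le s (star s))
    rcases (apply_nonneg (opSeminorm α) s).eq_or_lt with h | h
    · rw [← h]; exact apply_nonneg _ _
    · rw [sq] at this
      exact le_of_mul_le_mul_left this h
  have h3 := h1 (star s)
  rw [star_star] at h3
  exact (mul_self_le_mul_self (apply_nonneg _ _) h2).trans ((sq _).symm.trans_le h3)

/-- Left multiplication by `u^m` brings row `m` to row `0`, so the entry is `⟨u^m s, u^m⟩`, while
`‖u^m‖² = ‖α^m(1)‖ ≤ 1`. -/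
theorem norm_ev_le (s : MatAlg α) (m : ℕ) : ‖s.ev m m‖ ≤ opSeminorm α s := by
  have h1 : s.ev m m = MatAlg.rowInner (MatAlg.u α ^ m * s) (MatAlg.u α ^ m) := by
    rw [MatAlg.rowInner, mul_assoc, MatAlg.ev_u_pow_mul, MatAlg.ev_mul_star_u_pow, zero_add]
  have h2 : ‖equiv α (MatAlg.u α ^ m)‖ ^ 2 ≤ 1 := by
    rw [norm_sq, MatAlg.rowInner, MatAlg.ev_mul_star_u_pow, ← mul_one (MatAlg.u α ^ m),
      MatAlg.ev_u_pow_mul, MatAlg.ev_one, if_pos rfl]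
    exact (norm_iter_le _ _).trans (cstar_norm_one_le A)
  rw [h1]
  refine (norm_rowInner_le _ _).trans ?_
  calc _ ≤ opSeminorm α s * ‖equiv α (MatAlg.u α ^ m)‖ * ‖equiv α (MatAlg.u α ^ m)‖ :=
        mul_le_mul_of_nonneg_right (norm_mul_le _ _) (norm_nonneg _)
    _ = opSeminorm α s * ‖equiv α (MatAlg.u α ^ m)‖ ^ 2 := by ring
    _ ≤ opSeminorm α s * 1 := mul_le_mul_of_nonneg_left h2 (apply_nonneg _ _)
    _ = opSeminorm α s := mul_one _

end RowSpace

end Toeplitz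

/-! ### The relative Toeplitz representation, enveloping algebras and universality -/

section Existence

open scoped CStarAlgebra

variable {A : Type u} [CStarAlgebra A] {α : A →⋆ₙₐ[ℂ] A} {J : TwoSidedIdeal A}

/-- The closure of the image of an ideal under a ring homomorphism with dense range. -/
noncomputable def closureMap {S T : Type*} [Ring S] [StarRing S] [Algebra ℂ S] [CStarAlgebra T]
    (ι : S →⋆ₐ[ℂ] T) (hι : DenseRange ι) (N : TwoSidedIdeal S) : TwoSidedIdeal T :=
  TwoSidedIdeal.mk' (closure (ι '' N))
    (subset_closure ⟨0, N.zero_mem, map_zero ι⟩)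
    (fun {x y} hx hy => map_mem_closure₂ continuous_add hx hy <| by
      rintro _ ⟨a, ha, rfl⟩ _ ⟨b, hb, rfl⟩
      exact ⟨a + b, N.add_mem ha hb, map_add ι a b⟩)
    (fun {x} hx => map_mem_closure continuous_neg hx <| by
      rintro _ ⟨a, ha, rfl⟩
      exact ⟨-a, N.neg_mem ha, map_neg ι a⟩)
    (fun {x y} hy => map_mem_closure₂ continuous_mul (hι x) hy <| by
      rintro _ ⟨a, rfl⟩ _ ⟨b, hb, rfl⟩
      exact ⟨a * b, N.mul_mem_left _ _ hb, map_mul ι a b⟩)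
    (fun {x y} hx => map_mem_closure₂ continuous_mul hx (hι y) <| by
      rintro _ ⟨a, ha, rfl⟩ _ ⟨b, rfl⟩
      exact ⟨a * b, N.mul_mem_right _ _ ha, map_mul ι a b⟩)

theorem coe_closureMap {S T : Type*} [Ring S] [StarRing S] [Algebra ℂ S] [CStarAlgebra T]
    (ι : S →⋆ₐ[ℂ] T) (hι : DenseRange ι) (N : TwoSidedIdeal S) :
    (closureMap ι hι N : Set T) = closure (ι '' N) :=
  Set.ext fun _ => TwoSidedIdeal.mem_mk' ..

variable (α) in
/-- A representation of the quotient of the matrix algebra whose kernel is controlled by the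
diagonal entries: the relative Toeplitz algebra. -/
theorem exists_toeplitz_rep (hJ : IsClosed (J : Set A)) :
    ∃ (D : Type u) (_ : CStarAlgebra D) (Ψ : MatQuot α J →⋆ₐ[ℂ] D), ∀ s : MatAlg α,
      Ψ (MatQuot.mk J s) = 0 →
        (∀ m, s.ev m m ∈ J) ∧ Tendsto (fun m => s.ev m m) atTop (𝓝 0) := by
  obtain ⟨T, _, ι, hι, hιn⟩ := exists_cstarCompletion (RowSpace.opSeminorm α)
    RowSpace.opSeminorm_mul_le RowSpace.opSeminorm_mul_self_le
  obtain ⟨D, _, ψ, hψ⟩ := exists_cstarQuotient (closureMap ι hι (nullIdeal α J))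
  rw [coe_closureMap, closure_closure] at hψ
  obtain ⟨Ψ, hΨ⟩ := MatQuot.exists_lift (ψ.comp ι) fun a ha =>
    (hψ _).2 (subset_closure ⟨a, ha, rfl⟩)
  refine ⟨D, inferInstance, Ψ, fun s hs => ?_⟩
  rw [hΨ, StarAlgHom.comp_apply, hψ, Metric.mem_closure_iff] at hs
  -- An element of the kernel is a norm limit of null elements, and the operator seminorm controls
  -- all diagonal entries at once. Membership in the closed ideal `J` and decay along the diagonal
  -- both survive uniform limits.
  have key : ∀ ε > 0, ∃ n : MatAlg α, (∀ m, n.ev m m ∈ J) ∧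
      Tendsto (fun m => n.ev m m) atTop (𝓝 0) ∧ ∀ m, ‖s.ev m m - n.ev m m‖ < ε := fun ε hε => by
    obtain ⟨_, ⟨n, hn, rfl⟩, hd⟩ := hs ε hε
    rw [SetLike.mem_coe, mem_nullIdeal, MatAlg.seminorm_eq_zero_iff, hJ.closure_eq] at hn
    refine ⟨n, fun m => hn.1 m m, by simpa using hn.2 0 0, fun m => ?_⟩
    rw [dist_eq_norm, ← map_sub, hιn] at hd
    have := RowSpace.norm_ev_le (s - n) m
    rw [MatAlg.ev_sub] at this
    exact this.trans_lt hd
  refine ⟨fun m => ?_, ?_⟩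
  · have : s.ev m m ∈ closure (J : Set A) := Metric.mem_closure_iff.2 fun ε hε => by
      obtain ⟨n, h1, -, h3⟩ := key ε hε
      exact ⟨n.ev m m, h1 m, by rw [dist_eq_norm]; exact h3 m⟩
    rwa [hJ.closure_eq] at this
  · refine Metric.tendsto_atTop.2 fun ε hε => ?_
    obtain ⟨n, -, h2, h3⟩ := key (ε / 2) (half_pos hε)
    obtain ⟨M, hM⟩ := Metric.tendsto_atTop.1 h2 (ε / 2) (half_pos hε)
    refine ⟨M, fun m hm => ?_⟩
    have h4 := hM m hm
    have h5 := norm_add_le (s.ev m m - n.ev m m) (n.ev m m)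
    rw [sub_add_cancel] at h5
    rw [dist_zero_right] at h4 ⊢
    linarith [h3 m]

/-- An endomorphism is isometric on an ideal meeting its kernel trivially. -/
theorem norm_map_eq_of_mem (hJ : IsClosed (J : Set A)) (hJα : ∀ a ∈ J, α a = 0 → a = 0) {a : A}
    (ha : a ∈ J) : ‖α a‖ = ‖a‖ := by
  let S : NonUnitalStarSubalgebra ℂ A :=
    { carrier := J
      add_mem' := J.add_mem
      zero_mem' := J.zero_mem
      mul_mem' := fun _ hb => J.mul_mem_left _ _ hb
      smul_mem' := fun c x hx => by
        rw [← one_mul x, ← smul_mul_assoc]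
        exact J.mul_mem_left _ _ hx
      star_mem' := fun {x} hx => by
        have := star_mem_closure J hx
        rwa [hJ.closure_eq] at this }
  -- Closedness makes `S` a C⋆-algebra, and an injective `*`-homomorphism of C⋆-algebras is
  -- isometric.
  have hS : IsClosed (S : Set A) := hJ
  let φ : S →⋆ₙₐ[ℂ] A := α.comp (NonUnitalStarSubalgebraClass.subtype S)
  refine NonUnitalStarAlgHom.norm_map φ ((injective_iff_map_eq_zero φ).2 fun x hx => ?_) ⟨a, ha⟩
  exact Subtype.ext (hJα x x.2 hx)

/-- The orbit stays in `J`, where `α` is isometric, so its norm is constantly `‖a‖` while tending to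
zero. -/
theorem eq_zero_of_tendsto (hJ : IsClosed (J : Set A)) (hJα : ∀ a ∈ J, α a = 0 → a = 0) {a : A}
    (ha : ∀ m, α^[m] a ∈ J) (h0 : Tendsto (fun m => α^[m] a) atTop (𝓝 0)) : a = 0 := by
  have h1 : ∀ m, ‖α^[m] a‖ = ‖a‖ := fun m => by
    induction m with
    | zero => rfl
    | succ m ih => rw [Function.iterate_succ_apply', norm_map_eq_of_mem hJ hJα (ha m), ih]
  have h2 := h0.norm
  simp only [h1, norm_zero] at h2
  exact norm_eq_zero.1 (tendsto_nhds_unique tendsto_const_nhds h2)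

/-- Since `u*u a = u* α(a) u` is a word starting at `(1, 1)`, it agrees with `a` along the main
diagonal except at the origin. -/
theorem MatAlg.ev_defect (a : A) (m n : ℕ) :
    (of α a - star (u α) * u α * of α a).ev m n = if m = 0 ∧ n = 0 then a else 0 := by
  have h : star (u α) * u α * of α a = unit α 1 1 (α a) := by
    rw [mul_assoc, u_mul_of, unit_eq, pow_one, pow_one, mul_assoc]
  rw [h, ev_sub, Matrix.sub_apply, ev_of, ev_unit]
  rcases m with _ | m
  · by_cases h0 : n = 0
    · simp [h0]
    · simp [h0, Ne.symm h0]
  · by_cases h0 : m + 1 = n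
    · subst h0
      rw [if_pos rfl, if_pos (by omega), if_neg (by omega), ← Function.iterate_succ_apply,
        show (m + 1 - 1).succ = m + 1 by omega, ← iter_mul, ← iter_mul, one_mul, mul_one, sub_self]
    · rw [if_neg h0, if_neg (by omega), if_neg (by omega), sub_zero]

/-- The defect `a - u*ua` vanishes in the quotient if `a ∈ J`. -/
theorem MatQuot.mk_defect (hJ : IsClosed (J : Set A)) {a : A} (ha : a ∈ J) :
    mk J (star (MatAlg.u α) * MatAlg.u α * MatAlg.of α a) = mk J (MatAlg.of α a) := by
  rw [eq_comm, mk_eq_mk, MatAlg.seminorm_eq_zero_iff, hJ.closure_eq]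
  refine ⟨fun m n => ?_, fun p q => ?_⟩
  · rw [MatAlg.ev_defect]
    split_ifs
    · exact ha
    · exact J.zero_mem
  · refine tendsto_const_nhds.congr' (eventually_atTop.2 ⟨1, fun i hi => ?_⟩)
    exact ((MatAlg.ev_defect a _ _).trans (if_neg (by omega))).symm

theorem MatAlg.u_mul_of_mul_star_u (a : A) : u α * of α a * star (u α) = of α (α a) := by
  rw [u_mul_of, mul_assoc, u_mul_star_u, ← ofHom_apply, ← ofHom_apply, ← map_mul, ← map_mul,
    mul_one]

/-! ### Representations of the quotient restricted to the generators -/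

section Restrict

variable {D : Type u} [CStarAlgebra D]

/-- The restriction to `A` of a `*`-homomorphism defined on the quotient of the matrix algebra. -/
noncomputable def restrict (ρ : MatQuot α J →⋆ₐ[ℂ] D) : A →⋆ₐ[ℂ] D :=
  (ρ.comp (MatQuot.mkHom α J)).comp (MatAlg.ofHom α)

theorem restrict_apply (ρ : MatQuot α J →⋆ₐ[ℂ] D) (a : A) :
    restrict ρ a = ρ (MatQuot.mk J (MatAlg.of α a)) := rfl

theorem restrict_conj (ρ : MatQuot α J →⋆ₐ[ℂ] D) (a : A) :
    ρ (MatQuot.mk J (MatAlg.u α)) * restrict ρ a * star (ρ (MatQuot.mk J (MatAlg.u α))) =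
      restrict ρ (α a) := by
  rw [restrict_apply, restrict_apply, ← MatAlg.u_mul_of_mul_star_u, MatQuot.mk_mul,
    MatQuot.mk_mul, MatQuot.mk_star, map_mul, map_mul, map_star]

theorem map_mk_unit (ρ : MatQuot α J →⋆ₐ[ℂ] D) (i j : ℕ) (x : A) :
    ρ (MatQuot.mk J (MatAlg.unit α i j x)) =
      word (restrict ρ) (ρ (MatQuot.mk J (MatAlg.u α))) i j x := by
  have : ρ (MatQuot.mk J (MatAlg.unit α i j x)) =
      (ρ.comp (MatQuot.mkHom α J)) (MatAlg.unit α i j x) := rfl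
  rw [this, MatAlg.unit_eq, map_mul, map_mul, map_pow, map_pow, map_star]
  rfl

theorem ideal_of_restrict (hJ : IsClosed (J : Set A)) (ρ : MatQuot α J →⋆ₐ[ℂ] D) {a : A}
    (ha : a ∈ J) : star (ρ (MatQuot.mk J (MatAlg.u α))) * ρ (MatQuot.mk J (MatAlg.u α)) *
      restrict ρ a = restrict ρ a := by
  rw [restrict_apply, ← map_star, ← map_mul, ← map_mul, ← MatQuot.mk_star, ← MatQuot.mk_mul,
    ← MatQuot.mk_mul, MatQuot.mk_defect hJ ha]

/-- Indeed `U U* = π(α(1))` and `π(α(1)) U = U π(1)`, so the conjugation relation alone makes `U` a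
partial isometry. -/
theorem mul_star_mul_of_conj {π : A →⋆ₐ[ℂ] D} {U : D} (h : ∀ a, U * π a * star U = π (α a)) :
    U * star U * U = U := by
  have h1 := mul_map_of_conj h 1
  have h2 := h 1
  rw [map_one, mul_one] at h1 h2
  rw [h2, ← h1]

end Restrict

variable (α J) in
/-- The norms of the image of an element under all representations are bounded. -/
theorem exists_norm_map_le (x : MatQuot α J) : ∃ C : ℝ, ∀ (D : Type u) [CStarAlgebra D]
    (ρ : MatQuot α J →⋆ₐ[ℂ] D), ‖ρ x‖ ≤ C := by
  obtain ⟨a, rfl⟩ := MatQuot.mk_surjective x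
  refine MatAlg.induction_on_unit (p := fun a => ∃ C : ℝ, ∀ (D : Type u) [CStarAlgebra D]
    (ρ : MatQuot α J →⋆ₐ[ℂ] D), ‖ρ (MatQuot.mkHom α J a)‖ ≤ C) a ⟨0, fun D _ ρ => by simp⟩ ?_ ?_
  · rintro x y ⟨C, hC⟩ ⟨C', hC'⟩
    refine ⟨C + C', fun D _ ρ => ?_⟩
    rw [map_add, map_add]
    exact (norm_add_le _ _).trans (add_le_add (hC D ρ) (hC' D ρ))
  -- The conjugation relation forces `‖U‖ ≤ 1`, so the bound does not depend on the representation.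
  · refine fun i j x => ⟨‖x‖, fun D _ ρ => ?_⟩
    rw [MatQuot.mkHom_apply, map_mk_unit]
    exact norm_word_le (norm_le_one_of_conj (restrict_conj ρ)) _ _ _

/-- A `*`-algebra all of whose elements are bounded in the representations on C⋆-algebras has an
enveloping C⋆-algebra. -/
theorem exists_enveloping {S : Type u} [Ring S] [StarRing S] [Algebra ℂ S] [StarModule ℂ S]
    (hS : ∀ x : S, ∃ C : ℝ, ∀ (D : Type u) [CStarAlgebra D] (ρ : S →⋆ₐ[ℂ] D), ‖ρ x‖ ≤ C) :
    ∃ (C : Type u) (_ : CStarAlgebra C) (ι : S →⋆ₐ[ℂ] C), IsEnvelopingCStarAlgebra ι := by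
  -- The representations range over a larger universe, but their norms form a set of reals, so the
  -- supremum makes sense without choosing a family of representations.
  let norms (x : S) : Set ℝ := {r | ∃ (D : Type u) (_ : CStarAlgebra D) (ρ : S →⋆ₐ[ℂ] D), ‖ρ x‖ = r}
  have hbdd : ∀ x, BddAbove (norms x) := fun x => by
    obtain ⟨C, hC⟩ := hS x
    refine ⟨C, ?_⟩
    rintro _ ⟨D, _, ρ, rfl⟩
    exact hC D ρ
  have hle : ∀ x (D : Type u) [CStarAlgebra D] (ρ : S →⋆ₐ[ℂ] D), ‖ρ x‖ ≤ sSup (norms x) :=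
    fun x D _ ρ => le_csSup (hbdd x) ⟨D, _, ρ, rfl⟩
  have hsup : ∀ x c, 0 ≤ c → (∀ (D : Type u) [CStarAlgebra D] (ρ : S →⋆ₐ[ℂ] D), ‖ρ x‖ ≤ c) →
      sSup (norms x) ≤ c := fun x c hc h => Real.sSup_le (by
    rintro _ ⟨D, _, ρ, rfl⟩
    exact h D ρ) hc
  have hnn : ∀ x, 0 ≤ sSup (norms x) := fun x => Real.sSup_nonneg (by
    rintro _ ⟨D, _, ρ, rfl⟩
    exact norm_nonneg _)
  let p : Seminorm ℂ S := Seminorm.ofSMulLE (fun x => sSup (norms x))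
    (le_antisymm (hsup 0 0 le_rfl fun D _ ρ => by simp) (hnn 0))
    (fun x y => hsup _ _ (add_nonneg (hnn x) (hnn y)) fun D _ ρ => by
      rw [map_add]
      exact (norm_add_le _ _).trans (add_le_add (hle x D ρ) (hle y D ρ)))
    (fun c x => hsup _ _ (mul_nonneg (norm_nonneg c) (hnn x)) fun D _ ρ => by
      rw [map_smul, norm_smul]
      exact mul_le_mul_of_nonneg_left (hle x D ρ) (norm_nonneg c))
  obtain ⟨C, hC, ι, hι, hn⟩ := exists_cstarCompletion p
    (fun x y => hsup _ _ (mul_nonneg (hnn x) (hnn y)) fun D _ ρ => by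
      rw [map_mul]
      exact (norm_mul_le _ _).trans (mul_le_mul (hle x D ρ) (hle y D ρ) (norm_nonneg _) (hnn x)))
    (fun x => by
      have h1 : p x ≤ √(p (star x * x)) := hsup _ _ (Real.sqrt_nonneg _) fun D _ ρ =>
        Real.le_sqrt_of_sq_le (by
          rw [sq, ← CStarRing.norm_star_mul_self, ← map_star, ← map_mul]
          exact hle _ D ρ)
      exact (mul_self_le_mul_self (hnn x) h1).trans_eq (Real.mul_self_sqrt (hnn _)))
  exact ⟨C, hC, ι, hι, fun D _ ρ =>
    exists_lift_of_norm_le ι hι ρ fun x => (hle x D ρ).trans_eq (hn x).symm⟩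

/-! ### The enveloping algebra is a universal crossed product -/

section Enveloping

variable {C : Type u} [CStarAlgebra C] {ι : MatQuot α J →⋆ₐ[ℂ] C}

/-- The point is that the ideal does not grow. If `u*u a = a` holds in `C`, it holds in the Toeplitz
representation, where the `(0, 0)` entry of the defect, namely `a`, must lie in `J`. -/
theorem IsEnvelopingCStarAlgebra.isCovariantRep (hJ : IsClosed (J : Set A))
    (hι : IsEnvelopingCStarAlgebra ι) :
    IsCovariantRep α J (restrict ι) (ι (MatQuot.mk J (MatAlg.u α))) where
  conj := restrict_conj ι
  ideal a := by
    refine ⟨ideal_of_restrict hJ ι, fun h => ?_⟩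
    obtain ⟨D, _, Ψ, hΨ⟩ := exists_toeplitz_rep α hJ
    obtain ⟨φ, hφ⟩ := hι.lift D Ψ
    have h1 := congrArg φ h
    rw [restrict_apply, ← map_star, ← map_mul, ← map_mul, hφ, hφ] at h1
    have h2 := (hΨ (MatAlg.of α a - star (MatAlg.u α) * MatAlg.u α * MatAlg.of α a) (by
      rw [← MatQuot.mkHom_apply, map_sub, map_sub, sub_eq_zero]
      exact h1.symm)).1 0
    rwa [MatAlg.ev_defect, if_pos ⟨rfl, rfl⟩] at h2

/-- An element of the kernel also dies in the Toeplitz representation. Its diagonal entries `α^m(a)`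
then lie in `J` and tend to zero, so `eq_zero_of_tendsto` applies. -/
theorem IsEnvelopingCStarAlgebra.restrict_injective (hJ : IsClosed (J : Set A))
    (hJα : ∀ a ∈ J, α a = 0 → a = 0) (hι : IsEnvelopingCStarAlgebra ι) :
    Function.Injective (restrict ι) := by
  refine (injective_iff_map_eq_zero _).2 fun a ha => ?_
  obtain ⟨D, _, Ψ, hΨ⟩ := exists_toeplitz_rep α hJ
  obtain ⟨φ, hφ⟩ := hι.lift D Ψ
  have h1 := congrArg φ ha
  rw [restrict_apply, hφ, map_zero] at h1
  have h2 := hΨ _ h1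
  simp only [MatAlg.ev_of, if_true] at h2
  exact eq_zero_of_tendsto hJ hJα h2.1 h2.2

theorem IsEnvelopingCStarAlgebra.isUniversalCrossedProduct (hJ : IsClosed (J : Set A))
    (hι : IsEnvelopingCStarAlgebra ι) :
    IsUniversalCrossedProduct α J (restrict ι) (ι (MatQuot.mk J (MatAlg.u α))) where
  partialIsometry := mul_star_mul_of_conj (restrict_conj ι)
  covariant := hι.isCovariantRep hJ
  generates := by
    refine eq_top_iff.2 fun c _ => ?_
    have hle : Set.range ι ⊆ (StarAlgebra.adjoin ℂ
        (Set.range (restrict ι) ∪ {ι (MatQuot.mk J (MatAlg.u α))}) : Set C) := by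
      rintro _ ⟨x, rfl⟩
      obtain ⟨a, rfl⟩ := MatQuot.mk_surjective x
      have hu := StarAlgebra.subset_adjoin ℂ
        (Set.range (restrict ι) ∪ {ι (MatQuot.mk J (MatAlg.u α))}) (Or.inr rfl)
      refine MatAlg.induction_on_unit (p := fun a => ι (MatQuot.mkHom α J a) ∈
        StarAlgebra.adjoin ℂ (Set.range (restrict ι) ∪ {ι (MatQuot.mk J (MatAlg.u α))})) a
        (by simp) (fun x y hx hy => ?_) fun i j x => ?_
      · rw [map_add, map_add]
        exact add_mem hx hy
      · rw [MatQuot.mkHom_apply, map_mk_unit]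
        exact mul_mem (mul_mem (pow_mem (star_mem hu) _)
          (StarAlgebra.subset_adjoin ℂ _ (Or.inl ⟨x, rfl⟩))) (pow_mem hu _)
    exact closure_mono hle (hι.denseRange c)
  lift D _ π U h := by
    obtain ⟨Ψ, h1, h2⟩ := h.exists_integrate hJ
    obtain ⟨φ, hφ⟩ := hι.lift D Ψ
    exact ⟨φ, fun a => (hφ _).trans (h1 a), (hφ _).trans h2⟩

/-- `*`-homomorphisms from an enveloping C⋆-algebra are determined on the generators. -/
theorem IsEnvelopingCStarAlgebra.hom_ext (hι : IsEnvelopingCStarAlgebra ι) {D : Type u}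
    [CStarAlgebra D] {φ ψ : C →⋆ₐ[ℂ] D} (h : ∀ a, φ (restrict ι a) = ψ (restrict ι a))
    (hu : φ (ι (MatQuot.mk J (MatAlg.u α))) = ψ (ι (MatQuot.mk J (MatAlg.u α)))) : φ = ψ := by
  refine eq_of_denseRange hι.denseRange fun x => ?_
  obtain ⟨a, rfl⟩ := MatQuot.mk_surjective x
  refine MatAlg.induction_on_unit (p := fun a => φ (ι (MatQuot.mkHom α J a)) =
    ψ (ι (MatQuot.mkHom α J a))) a (by simp) (fun x y hx hy => ?_) fun i j x => ?_
  · simp only [map_add, hx, hy]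
  · rw [MatQuot.mkHom_apply, map_mk_unit, word]
    simp only [map_mul, map_pow, map_star, h, hu]

end Enveloping

/-- `*`-homomorphisms from a universal crossed product are determined on the generators. -/
theorem IsUniversalCrossedProduct.hom_ext {B : Type u} [CStarAlgebra B] {i : A →⋆ₐ[ℂ] B} {v : B}
    (hB : IsUniversalCrossedProduct α J i v) {D : Type u} [CStarAlgebra D] {φ ψ : B →⋆ₐ[ℂ] D}
    (h : ∀ a, φ (i a) = ψ (i a)) (hv : φ v = ψ v) : φ = ψ := by
  have h1 : (StarAlgebra.adjoin ℂ (Set.range i ∪ {v})).topologicalClosure ≤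
      StarAlgHom.equalizer φ ψ := by
    refine StarSubalgebra.topologicalClosure_minimal (StarAlgebra.adjoin_le ?_)
      (isClosed_eq (map_continuous φ) (map_continuous ψ))
    rintro _ (⟨a, rfl⟩ | rfl)
    · exact h a
    · exact hv
  rw [hB.generates] at h1
  exact StarAlgHom.ext fun x => h1 (StarSubalgebra.mem_top (x := x))

end Existence

end EndoCrossed

/-! ### The canonical isomorphism of the two crossed products -/

theorem mainTheorem6 {A : Type u} [CStarAlgebra A] (α : A →⋆ₙₐ[ℂ] A) (J : TwoSidedIdeal A)
    (hJ : IsClosed (J : Set A)) (hJα : ∀ a ∈ J, α a = 0 → a = 0) :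
    (∃ (B : Type u) (_ : CStarAlgebra B) (i : A →⋆ₐ[ℂ] B) (v : B),
      EndoCrossed.IsUniversalCrossedProduct α J i v ∧ Function.Injective i) ∧
    (∃ (C : Type u) (_ : CStarAlgebra C) (ι : EndoCrossed.MatQuot α J →⋆ₐ[ℂ] C),
      EndoCrossed.IsEnvelopingCStarAlgebra ι) ∧
    ∀ (B : Type u) [CStarAlgebra B] (i : A →⋆ₐ[ℂ] B) (v : B)
      (C : Type u) [CStarAlgebra C] (ι : EndoCrossed.MatQuot α J →⋆ₐ[ℂ] C),
      EndoCrossed.IsUniversalCrossedProduct α J i v → EndoCrossed.IsEnvelopingCStarAlgebra ι →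
      ∃! φ : B ≃⋆ₐ[ℂ] C,
        (∀ a, φ (i a) = ι (EndoCrossed.MatQuot.mk J (EndoCrossed.MatAlg.of α a))) ∧
        φ v = ι (EndoCrossed.MatQuot.mk J (EndoCrossed.MatAlg.u α)) := by
  obtain ⟨C₀, _, ι₀, hι₀⟩ := EndoCrossed.exists_enveloping (EndoCrossed.exists_norm_map_le α J)
  refine ⟨⟨C₀, inferInstance, _, _, hι₀.isUniversalCrossedProduct hJ,
    hι₀.restrict_injective hJ hJα⟩, ⟨C₀, inferInstance, ι₀, hι₀⟩, ?_⟩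
  intro B _ i v C _ ι hB hC
  -- Both `B` and `C` are universal for `J`-covariant representations, so there are maps in both
  -- directions matching the generators. They are mutually inverse because the generators determine
  -- `*`-homomorphisms, which also gives uniqueness.
  obtain ⟨φ, hφi, hφv⟩ := hB.lift C _ _ (hC.isCovariantRep hJ)
  obtain ⟨ψ, hψi, hψv⟩ := (hC.isUniversalCrossedProduct hJ).lift B i v hB.covariant
  refine ⟨StarAlgEquiv.ofStarAlgHom φ ψ ?_ ?_, ⟨hφi, hφv⟩, fun χ hχ => ?_⟩
  · exact hB.hom_ext (fun a => by simp [hφi, hψi]) (by simp [hφv, hψv])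
  · exact hC.hom_ext (fun a => by simp [hφi, hψi]) (by simp [hφv, hψv])
  · have h : (χ : B →⋆ₐ[ℂ] C) = φ := hB.hom_ext
      (fun a => (hχ.1 a).trans (hφi a).symm) (hχ.2.trans hφv.symm)
    exact StarAlgEquiv.ext fun x => congrArg (fun f : B →⋆ₐ[ℂ] C => f x) h
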